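/- Let $(M,\varphi,\xi,\eta,g)$ be an almost contact B-metric manifold: $M$ is a smooth manifold of dimension $2n+1$, $\varphi$ is a smooth endomorphism field of $TM$, $\xi$ a smooth vector field, $\eta$ a smooth 1-form and $g$ a pseudo-Riemannian metric such that $$\varphi\xi=0,\quad \varphi^2=-\mathrm{Id}+\eta\otimes\xi,\quad \eta\circ\varphi=0,\quad \eta(\xi)=1,\quad g(\varphi x,\varphi y)=-g(x,y)+\eta(x)\eta(y)$$ (so $g$ has signature $(n,n+1)$). Let $\nabla$ be the Levi-Civita connection of $g$, and let $N=[\varphi,\varphi]+d\eta\otimes\xi$ be the Nijenhuis tensor, where $[\varphi,\varphi](x,y)=[\varphi x,\varphi y]+\varphi^2[x,y]-\varphi[\varphi x,y]-\varphi[x,\varphi y]$, $d\eta(x,y)=x\,\eta(y)-y\,\eta(x)-\eta([x,y])$ and $N(x,y,z)=g(N(x,y),z)$. Let $\nabla'$ be the linear connection defined by $g(\nabla'_xy,z)=g(\nabla_xy,z)+Q'(x,y,z)$, where $$Q'(x,y,z)=g(Q^0(x,y),z)-\tfrac18\bigl\{N(\varphi^2z,\varphi^2y,\varphi^2x)+2N(\varphi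 z,\varphi y,\xi)\,\eta(x)\bigr\},$$ $$Q^0(x,y)=\tfrac12\bigl\{(\nabla_x\varphi)\varphi y+(\nabla_x\eta)(y)\,\xi\bigr\}-\eta(y)\nabla_x\xi ,$$ and let $T'(x,y)=\nabla'_xy-\nabla'_yx-[x,y]$ be its torsion. Then $\nabla'$ is a $\varphi$-canonical connection, i.e. $\nabla'\varphi=\nabla'\xi=\nabla'\eta=\nabla'g=0$ and $T=T'$, with $T(x,y,z)=g(T(x,y),z)$, satisfies $$\begin{aligned}\bigl\{&T(x,y,z)-T(x,\varphi y,\varphi z)-\eta(x)\{T(\xi,y,z)-T(\xi,\varphi y,\varphi z)\}\\&-\eta(y)\{T(x,\xi,z)-T(x,z,\xi)-\eta(x)T(z,\xi,\xi)\}\bigr\}_{[y\leftrightarrow z]}=0,\end{aligned}$$ where $\{A(y,z)\}_{[y\leftrightarrow z]}=A(y,z)-A(z,y)$; it is called the $\varphi$-canonical connection of $(M,\varphi,\xi,\eta,g)$. Let $u,v,w$ be smooth functions on $M$, let $(M,\varphi,\bar\xi,\bar\eta,\bar g)$ be the almost contact B-metric manifold with the same $\varphi$ and $$\bar\xi=e^{-w}\xi,\quad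 \bar\eta=e^{w}\eta,\quad \bar g(x,y)=e^{2u}\cos 2v\; g(x,y)+e^{2u}\sin 2v\; g(x,\varphi y)+(e^{2w}-e^{2u}\cos 2v)\,\eta(x)\eta(y),$$ and let $\bar\nabla'$ be its $\varphi$-canonical connection, defined in the same way from the transformed structure, with torsion $\bar T'$. With $p=\operatorname{grad}u$ and $q=\operatorname{grad}v$ taken with respect to $g$, for all vector fields $x,y$ one has $$\begin{aligned}\bar\nabla'_xy=\nabla'_xy&-du(x)\varphi^2y+dv(x)\varphi y+dw(x)\eta(y)\xi\\&+\tfrac12\bigl\{[du(\varphi^2y)-dv(\varphi y)]\varphi^2x-[du(\varphi y)+dv(\varphi^2y)]\varphi x\\&\qquad-g(\varphi x,\varphi y)[\varphi^2p-\varphi q]+g(x,\varphi y)[\varphi p+\varphi^2q]\bigr\},\end{aligned}$$ $$\begin{aligned}\bar T'(x,y)=T'(x,y)+\tfrac12\bigl\{&2\,dw(x)\eta(y)\xi+[du(\varphi^2x)+dv(\varphi x)-2du(\xi)\eta(x)]\varphi^2y\\&+[du(\varphi x)-dv(\varphi^2x)+2dv(\xi)\eta(x)]\varphi y\bigr\}_{[x\leftrightarrow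 y]} .\end{aligned}$$ -/

import Mathlib

open Bundle Set FiberBundle VectorField
open scoped Manifold ContDiff Topology

noncomputable section

set_option linter.unusedSectionVars false

namespace BMetric

variable {E : Type*} [NormedAddCommGroup E] [NormedSpace ℝ E] [FiniteDimensional ℝ E]
  {H : Type*} [TopologicalSpace H] {I : ModelWithCorners ℝ E H}
  {M : Type*} [TopologicalSpace M] [ChartedSpace H M] [IsManifold I ∞ M]

/-! ### Pseudo-Riemannian metrics and the Levi-Civita connection -/

/-- A smooth pseudo-Riemannian metric (of arbitrary signature) on the manifold `M`. -/
structure PseudoMetric (I : ModelWithCorners ℝ E H) (M : Type*) [TopologicalSpace M]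
    [ChartedSpace H M] [IsManifold I ∞ M] where
  /-- The bilinear form on each tangent space. -/
  form (p : M) : TangentSpace I p →L[ℝ] TangentSpace I p →L[ℝ] ℝ
  symm (p : M) (v w : TangentSpace I p) : form p v w = form p w v
  nondegenerate (p : M) (v : TangentSpace I p) : (∀ w, form p v w = 0) → v = 0
  smooth : ContMDiff I (I.prod 𝓘(ℝ, E →L[ℝ] E →L[ℝ] ℝ)) ∞
    (fun p ↦ TotalSpace.mk' (E →L[ℝ] E →L[ℝ] ℝ)
      (E := fun p : M ↦ TangentSpace I p →L[ℝ] TangentSpace I p →L[ℝ] Trivial M ℝ p) p (form p))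

instance instFiniteDimensionalTangentSpace (p : M) : FiniteDimensional ℝ (TangentSpace I p) :=
  inferInstanceAs (FiniteDimensional ℝ E)

instance instT2SpaceTangentSpace (p : M) : T2Space (TangentSpace I p) :=
  inferInstanceAs (T2Space E)

namespace PseudoMetric

variable (g : PseudoMetric I M)

lemma mdiffAt_form {Y Z : Π p : M, TangentSpace I p} {p : M}
    (hY : MDiffAt (T% Y) p) (hZ : MDiffAt (T% Z) p) :
    MDiffAt (fun q ↦ g.form q (Y q) (Z q)) p := by
  have h := (g.smooth.mdifferentiable (by simp) p).clm_bundle_apply₂ hY hZ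
  simp only [mdifferentiableAt_totalSpace] at h
  exact h.2

lemma flat_injective (p : M) : Function.Injective (g.form p) := by
  rw [injective_iff_map_eq_zero]
  intro v hv
  exact g.nondegenerate p v fun w ↦ by rw [hv]; rfl

/-- The musical isomorphism: `g.sharp p α` is the tangent vector representing the covector `α`. -/
def sharp (p : M) : (TangentSpace I p →L[ℝ] ℝ) ≃ₗ[ℝ] TangentSpace I p :=
  ((LinearEquiv.ofInjectiveOfFinrankEq (g.form p).toLinearMap (g.flat_injective p) (by
    exact (Subspace.dual_finrank_eq (K := ℝ) (V := TangentSpace I p)).symm.trans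
      (LinearMap.toContinuousLinearMap :
        (TangentSpace I p →ₗ[ℝ] ℝ) ≃ₗ[ℝ] (TangentSpace I p →L[ℝ] ℝ)).finrank_eq))).symm

@[simp] lemma form_sharp (p : M) (α : TangentSpace I p →L[ℝ] ℝ) :
    g.form p (g.sharp p α) = α :=
  (g.sharp p).symm_apply_apply α

/-- The gradient of a function: `g (grad f, w) = df(w)`. -/
def grad (f : M → ℝ) (p : M) : TangentSpace I p := g.sharp p (mvfderiv I f p)

/-- The right-hand side of the Koszul formula for `2 g(∇_X Y, Z)` at the point `p`. -/
def koszul (Y X Z : Π p : M, TangentSpace I p) (p : M) : ℝ :=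
  mvfderiv I (fun q ↦ g.form q (Y q) (Z q)) p (X p)
  + mvfderiv I (fun q ↦ g.form q (X q) (Z q)) p (Y p)
  - mvfderiv I (fun q ↦ g.form q (X q) (Y q)) p (Z p)
  + g.form p (mlieBracket I X Y p) (Z p)
  + g.form p (mlieBracket I Z X p) (Y p)
  + g.form p (mlieBracket I Z Y p) (X p)

lemma koszul_tensorial_right {Y X : Π p : M, TangentSpace I p} {p : M}
    (hY : MDiffAt (T% Y) p) (hX : MDiffAt (T% X) p) :
    TensorialAt I E (g.koszul Y X · p) p where
  smul {f Z} hf hZ := by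
    have h1 : (fun q ↦ g.form q (Y q) ((f • Z) q)) = f * fun q ↦ g.form q (Y q) (Z q) := by
      ext q; simp
    have h2 : (fun q ↦ g.form q (X q) ((f • Z) q)) = f * fun q ↦ g.form q (X q) (Z q) := by
      ext q; simp
    simp only [koszul, h1, h2]
    rw [mvfderiv_mul hf (g.mdiffAt_form hY hZ), mvfderiv_mul hf (g.mdiffAt_form hX hZ),
      mlieBracket_smul_left hf hZ, mlieBracket_smul_left hf hZ]
    simp [g.symm p (Z p)]
    ring
  add {Z Z'} hZ hZ' := by
    have h1 : (fun q ↦ g.form q (Y q) ((Z + Z') q))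
        = (fun q ↦ g.form q (Y q) (Z q)) + fun q ↦ g.form q (Y q) (Z' q) := by
      ext q; simp
    have h2 : (fun q ↦ g.form q (X q) ((Z + Z') q))
        = (fun q ↦ g.form q (X q) (Z q)) + fun q ↦ g.form q (X q) (Z' q) := by
      ext q; simp
    simp only [koszul, h1, h2]
    rw [mvfderiv_add (g.mdiffAt_form hY hZ) (g.mdiffAt_form hY hZ'),
      mvfderiv_add (g.mdiffAt_form hX hZ) (g.mdiffAt_form hX hZ'),
      mlieBracket_add_left hZ hZ', mlieBracket_add_left hZ hZ']
    simp
    ring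

lemma koszul_tensorial_left {Y Z : Π p : M, TangentSpace I p} {p : M}
    (hY : MDiffAt (T% Y) p) (hZ : MDiffAt (T% Z) p) :
    TensorialAt I E (g.koszul Y · Z p) p where
  smul {f X} hf hX := by
    have h1 : (fun q ↦ g.form q ((f • X) q) (Z q)) = f * fun q ↦ g.form q (X q) (Z q) := by
      ext q; simp
    have h2 : (fun q ↦ g.form q ((f • X) q) (Y q)) = f * fun q ↦ g.form q (X q) (Y q) := by
      ext q; simp
    simp only [koszul, h1, h2]
    rw [mvfderiv_mul hf (g.mdiffAt_form hX hZ), mvfderiv_mul hf (g.mdiffAt_form hX hY),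
      mlieBracket_smul_left hf hX, mlieBracket_smul_right hf hX]
    simp
    ring
  add {X X'} hX hX' := by
    have h1 : (fun q ↦ g.form q ((X + X') q) (Z q))
        = (fun q ↦ g.form q (X q) (Z q)) + fun q ↦ g.form q (X' q) (Z q) := by
      ext q; simp
    have h2 : (fun q ↦ g.form q ((X + X') q) (Y q))
        = (fun q ↦ g.form q (X q) (Y q)) + fun q ↦ g.form q (X' q) (Y q) := by
      ext q; simp
    simp only [koszul, h1, h2]
    rw [mvfderiv_add (g.mdiffAt_form hX hZ) (g.mdiffAt_form hX' hZ),
      mvfderiv_add (g.mdiffAt_form hX hY) (g.mdiffAt_form hX' hY),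
      mlieBracket_add_left hX hX', mlieBracket_add_right hX hX']
    simp
    ring

open Classical in
/-- The map `Y ↦ ∇Y` underlying the Levi-Civita connection, determined by the Koszul formula. -/
def leviCivitaFun (Y : Π p : M, TangentSpace I p) (p : M) :
    TangentSpace I p →L[ℝ] TangentSpace I p :=
  if hY : MDiffAt (T% Y) p then
    (2⁻¹ : ℝ) • (LinearMap.toContinuousLinearMap (g.sharp p).toLinearMap).comp
      (TensorialAt.mkHom₂ (F := E) (F' := E) (g.koszul Y · · p) p
        (fun _ hZ ↦ g.koszul_tensorial_left hY hZ) (fun _ hX ↦ g.koszul_tensorial_right hY hX))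
  else 0

lemma koszul_formula {Y X Z : Π p : M, TangentSpace I p} {p : M} (hY : MDiffAt (T% Y) p)
    (hX : MDiffAt (T% X) p) (hZ : MDiffAt (T% Z) p) :
    2 * g.form p (g.leviCivitaFun Y p (X p)) (Z p) = g.koszul Y X Z p := by
  simp only [leviCivitaFun, dif_pos hY]
  have h := TensorialAt.mkHom₂_apply (F := E) (F' := E)
    (fun _ hZ ↦ g.koszul_tensorial_left hY hZ) (fun _ hX ↦ g.koszul_tensorial_right hY hX) hX hZ
  rw [← h]
  simp

lemma koszul_add {Y Y' X Z : Π p : M, TangentSpace I p} {p : M} (hY : MDiffAt (T% Y) p)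
    (hY' : MDiffAt (T% Y') p) (hX : MDiffAt (T% X) p) (hZ : MDiffAt (T% Z) p) :
    g.koszul (Y + Y') X Z p = g.koszul Y X Z p + g.koszul Y' X Z p := by
  have h1 : (fun q ↦ g.form q ((Y + Y') q) (Z q))
      = (fun q ↦ g.form q (Y q) (Z q)) + fun q ↦ g.form q (Y' q) (Z q) := by
    ext q; simp
  have h2 : (fun q ↦ g.form q (X q) ((Y + Y') q))
      = (fun q ↦ g.form q (X q) (Y q)) + fun q ↦ g.form q (X q) (Y' q) := by
    ext q; simp
  simp only [koszul, h1, h2]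
  rw [mvfderiv_add (g.mdiffAt_form hY hZ) (g.mdiffAt_form hY' hZ),
    mvfderiv_add (g.mdiffAt_form hX hY) (g.mdiffAt_form hX hY'),
    mlieBracket_add_right hY hY', mlieBracket_add_right hY hY']
  simp
  ring

lemma koszul_smul {f : M → ℝ} {Y X Z : Π p : M, TangentSpace I p} {p : M} (hf : MDiffAt f p)
    (hY : MDiffAt (T% Y) p) (hX : MDiffAt (T% X) p) (hZ : MDiffAt (T% Z) p) :
    g.koszul (f • Y) X Z p
      = f p * g.koszul Y X Z p + 2 * (mvfderiv I f p (X p) * g.form p (Y p) (Z p)) := by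
  have h1 : (fun q ↦ g.form q ((f • Y) q) (Z q)) = f * fun q ↦ g.form q (Y q) (Z q) := by
    ext q; simp
  have h2 : (fun q ↦ g.form q (X q) ((f • Y) q)) = f * fun q ↦ g.form q (X q) (Y q) := by
    ext q; simp
  simp only [koszul, h1, h2]
  rw [mvfderiv_mul hf (g.mdiffAt_form hY hZ), mvfderiv_mul hf (g.mdiffAt_form hX hY),
    mlieBracket_smul_right hf hY, mlieBracket_smul_right hf hY]
  simp [g.symm p (Y p) (X p)]
  ring

/-- The Levi-Civita connection of a pseudo-Riemannian metric. -/
def leviCivita : CovariantDerivative I E (fun p : M ↦ TangentSpace I p) where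
  toFun := g.leviCivitaFun
  isCovariantDerivativeOnUniv :=
    { add := by
        intro Y Y' p hY hY' _
        have hs : MDiffAt (T% (Y + Y')) p := mdifferentiableAt_add_section hY hY'
        refine ContinuousLinearMap.ext fun v ↦ g.flat_injective p ?_
        refine ContinuousLinearMap.ext fun w ↦ ?_
        have hv := mdifferentiableAt_extend I E v
        have hw := mdifferentiableAt_extend I E w
        have h1 := g.koszul_formula hs hv hw
        rw [g.koszul_add hY hY' hv hw, ← g.koszul_formula hY hv hw,
          ← g.koszul_formula hY' hv hw] at h1
        simp only [extend_apply_self] at h1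
        simp only [add_apply, map_add]
        linarith
      leibniz := by
        intro Y f p hY hf _
        have hs : MDiffAt (T% (f • Y)) p := hf.smul_section hY
        refine ContinuousLinearMap.ext fun v ↦ g.flat_injective p ?_
        refine ContinuousLinearMap.ext fun w ↦ ?_
        have hv := mdifferentiableAt_extend I E v
        have hw := mdifferentiableAt_extend I E w
        have h1 := g.koszul_formula hs hv hw
        rw [g.koszul_smul hf hY hv hw, ← g.koszul_formula hY hv hw] at h1
        simp only [extend_apply_self] at h1
        simp only [add_apply, map_add, smul_apply, map_smul, smul_eq_mul,
          ContinuousLinearMap.smulRight_apply]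
        linarith }

end PseudoMetric

/-! ### Almost contact B-metric structures -/

/-- An almost contact B-metric structure `(φ, ξ, η, g)` on the manifold `M`. When `M` has dimension
`2n+1`, the algebraic relations force the signature of `g` to be `(n, n+1)`: `g(ξ, ξ) = 1`, the
vector field `ξ` is orthogonal to `ker η`, and `φ` is an anti-isometry of `ker η`. -/
structure AlmostContactBMetric (I : ModelWithCorners ℝ E H) (M : Type*) [TopologicalSpace M]
    [ChartedSpace H M] [IsManifold I ∞ M] where
  /-- The endomorphism `φ` of the tangent bundle. -/
  phi (p : M) : TangentSpace I p →L[ℝ] TangentSpace I p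
  /-- The vector field `ξ`. -/
  xi (p : M) : TangentSpace I p
  /-- The 1-form `η`. -/
  eta (p : M) : TangentSpace I p →L[ℝ] ℝ
  /-- The B-metric `g`. -/
  metric : PseudoMetric I M
  phi_xi (p : M) : phi p (xi p) = 0
  phi_phi (p : M) (v : TangentSpace I p) : phi p (phi p v) = -v + eta p v • xi p
  eta_phi (p : M) (v : TangentSpace I p) : eta p (phi p v) = 0
  eta_xi (p : M) : eta p (xi p) = 1
  metric_phi (p : M) (v w : TangentSpace I p) :
    metric.form p (phi p v) (phi p w) = -metric.form p v w + eta p v * eta p w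
  smooth_phi : ContMDiff I (I.prod 𝓘(ℝ, E →L[ℝ] E)) ∞
    (fun p ↦ TotalSpace.mk' (E →L[ℝ] E)
      (E := fun p : M ↦ TangentSpace I p →L[ℝ] TangentSpace I p) p (phi p))
  smooth_xi : ContMDiff I (I.prod 𝓘(ℝ, E)) ∞
    (fun p ↦ TotalSpace.mk' E (E := fun p : M ↦ TangentSpace I p) p (xi p))
  smooth_eta : ContMDiff I (I.prod 𝓘(ℝ, E →L[ℝ] ℝ)) ∞
    (fun p ↦ TotalSpace.mk' (E →L[ℝ] ℝ)
      (E := fun p : M ↦ TangentSpace I p →L[ℝ] Trivial M ℝ p) p (eta p))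

namespace AlmostContactBMetric

variable (S : AlmostContactBMetric I M)

/-- The pointwise inner product `g(v, w)`. -/
abbrev g (p : M) (v w : TangentSpace I p) : ℝ := S.metric.form p v w

/-- The vector field `φY`. -/
def phiField (Y : Π p : M, TangentSpace I p) (p : M) : TangentSpace I p := S.phi p (Y p)

/-- The function `η(Y)`. -/
def etaField (Y : Π p : M, TangentSpace I p) (p : M) : ℝ := S.eta p (Y p)

lemma mdiffAt_phiField {Y : Π p : M, TangentSpace I p} {p : M} (hY : MDiffAt (T% Y) p) :
    MDiffAt (T% (S.phiField Y)) p :=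
  (S.smooth_phi.mdifferentiable (by simp) p).clm_bundle_apply hY

lemma mdiffAt_etaField {Y : Π p : M, TangentSpace I p} {p : M} (hY : MDiffAt (T% Y) p) :
    MDiffAt (S.etaField Y) p := by
  have h := (S.smooth_eta.mdifferentiable (by simp) p).clm_bundle_apply hY
  simp only [mdifferentiableAt_totalSpace] at h
  exact h.2

lemma phiField_add (Y Y' : Π p : M, TangentSpace I p) :
    S.phiField (Y + Y') = S.phiField Y + S.phiField Y' := by
  ext p; simp [phiField]

lemma phiField_smul (f : M → ℝ) (Y : Π p : M, TangentSpace I p) :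
    S.phiField (f • Y) = f • S.phiField Y := by
  ext p; simp [phiField]

lemma etaField_add (Y Y' : Π p : M, TangentSpace I p) :
    S.etaField (Y + Y') = S.etaField Y + S.etaField Y' := by
  ext p; simp [etaField]

lemma etaField_smul (f : M → ℝ) (Y : Π p : M, TangentSpace I p) :
    S.etaField (f • Y) = f * S.etaField Y := by
  ext p; simp [etaField]

/-! Covariant derivatives of the structure tensors with respect to a linear connection `D`. -/

section Nabla

variable (D : CovariantDerivative I E (fun p : M ↦ TangentSpace I p))

lemma nablaPhi_tensorial (p : M) :
    TensorialAt I E (fun Y : Π p : M, TangentSpace I p ↦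
      D (S.phiField Y) p - (S.phi p).comp (D Y p)) p where
  smul {f Y} hf hY := by
    simp only [phiField_smul]
    rw [D.isCovariantDerivativeOn.leibniz (S.mdiffAt_phiField hY) hf,
      D.isCovariantDerivativeOn.leibniz hY hf]
    ext v
    simp [phiField]
    module
  add {Y Y'} hY hY' := by
    simp only [phiField_add]
    rw [D.isCovariantDerivativeOn.add (S.mdiffAt_phiField hY) (S.mdiffAt_phiField hY'),
      D.isCovariantDerivativeOn.add hY hY']
    ext v
    simp
    module

/-- The tensor `Dφ`, with the argument of `φ` first and the direction of derivation second. -/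
def nablaPhiTensor (p : M) :
    TangentSpace I p →L[ℝ] TangentSpace I p →L[ℝ] TangentSpace I p :=
  TensorialAt.mkHom (F := E) (fun Y : Π p : M, TangentSpace I p ↦
    D (S.phiField Y) p - (S.phi p).comp (D Y p)) p (S.nablaPhi_tensorial D p)

/-- `(D_x φ) y = D_x (φ y) - φ (D_x y)`. -/
def nablaPhi (p : M) (x y : TangentSpace I p) : TangentSpace I p := S.nablaPhiTensor D p y x

lemma nablaEta_tensorial (p : M) :
    TensorialAt I E (fun Y : Π p : M, TangentSpace I p ↦
      mvfderiv I (S.etaField Y) p - (S.eta p).comp (D Y p)) p where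
  smul {f Y} hf hY := by
    simp only [etaField_smul]
    rw [D.isCovariantDerivativeOn.leibniz hY hf, mvfderiv_mul hf (S.mdiffAt_etaField hY)]
    ext v
    simp [etaField]
    ring
  add {Y Y'} hY hY' := by
    simp only [etaField_add]
    rw [D.isCovariantDerivativeOn.add hY hY',
      mvfderiv_add (S.mdiffAt_etaField hY) (S.mdiffAt_etaField hY')]
    ext v
    simp
    ring

/-- The tensor `Dη`, with the argument of `η` first and the direction of derivation second. -/
def nablaEtaTensor (p : M) : TangentSpace I p →L[ℝ] TangentSpace I p →L[ℝ] ℝ :=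
  TensorialAt.mkHom (F := E) (fun Y : Π p : M, TangentSpace I p ↦
    mvfderiv I (S.etaField Y) p - (S.eta p).comp (D Y p)) p (S.nablaEta_tensorial D p)

/-- `(D_x η) y = x (η y) - η (D_x y)`. -/
def nablaEta (p : M) (x y : TangentSpace I p) : ℝ := S.nablaEtaTensor D p y x

/-- `D` is a natural connection: `Dφ = 0`, `Dξ = 0`, `Dη = 0` and `Dg = 0`. -/
structure IsNatural : Prop where
  phi_parallel (p : M) (x y : TangentSpace I p) : S.nablaPhi D p x y = 0
  xi_parallel (p : M) (x : TangentSpace I p) : D S.xi p x = 0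
  eta_parallel (p : M) (x y : TangentSpace I p) : S.nablaEta D p x y = 0
  metric_parallel (p : M) (Y Z : Π p : M, TangentSpace I p) (v : TangentSpace I p) :
    MDiffAt (T% Y) p → MDiffAt (T% Z) p →
      mvfderiv I (fun q ↦ S.g q (Y q) (Z q)) p v
        = S.g p (D Y p v) (Z p) + S.g p (Y p) (D Z p v)

/-- The torsion tensor of type (0,3): `T(x, y, z) = g(T(x, y), z)`. -/
def torsion3 (p : M) (x y z : TangentSpace I p) : ℝ := S.g p (D.torsion p x y) z

/-- The expression whose antisymmetrization in `y, z` vanishes for a `φ`-canonical connection. -/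
def torsionExpr (p : M) (x y z : TangentSpace I p) : ℝ :=
  S.torsion3 D p x y z - S.torsion3 D p x (S.phi p y) (S.phi p z)
  - S.eta p x * (S.torsion3 D p (S.xi p) y z
      - S.torsion3 D p (S.xi p) (S.phi p y) (S.phi p z))
  - S.eta p y * (S.torsion3 D p x (S.xi p) z - S.torsion3 D p x z (S.xi p)
      - S.eta p x * S.torsion3 D p z (S.xi p) (S.xi p))

/-- A natural connection is `φ`-canonical if its torsion satisfies the identity
`{T(x,y,z) - T(x,φy,φz) - η(x){T(ξ,y,z) - T(ξ,φy,φz)}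
  - η(y){T(x,ξ,z) - T(x,z,ξ) - η(x)T(z,ξ,ξ)}}_{[y ↔ z]} = 0`. -/
structure IsPhiCanonical : Prop extends S.IsNatural D where
  torsion_identity (p : M) (x y z : TangentSpace I p) :
    S.torsionExpr D p x y z - S.torsionExpr D p x z y = 0

end Nabla

/-! The Nijenhuis tensor. -/

/-- `[φ, φ](X, Y) + dη(X, Y) ξ` for vector fields, where
`[φ, φ](X, Y) = [φX, φY] + φ²[X, Y] - φ[φX, Y] - φ[X, φY]` and
`dη(X, Y) = X(η(Y)) - Y(η(X)) - η([X, Y])`. -/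
def nijenhuisFun (p : M) (X Y : Π p : M, TangentSpace I p) : TangentSpace I p :=
  mlieBracket I (S.phiField X) (S.phiField Y) p
  + S.phi p (S.phi p (mlieBracket I X Y p))
  - S.phi p (mlieBracket I (S.phiField X) Y p)
  - S.phi p (mlieBracket I X (S.phiField Y) p)
  + (mvfderiv I (S.etaField Y) p (X p) - mvfderiv I (S.etaField X) p (Y p)
      - S.eta p (mlieBracket I X Y p)) • S.xi p

lemma nijenhuisFun_swap (p : M) (X Y : Π p : M, TangentSpace I p) :
    S.nijenhuisFun p X Y = -S.nijenhuisFun p Y X := by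
  simp only [nijenhuisFun]
  rw [mlieBracket_swap_apply (V := S.phiField X) (W := S.phiField Y),
    mlieBracket_swap_apply (V := X) (W := Y), mlieBracket_swap_apply (V := S.phiField X) (W := Y),
    mlieBracket_swap_apply (V := X) (W := S.phiField Y)]
  simp only [map_neg]
  module

lemma nijenhuis_tensorial_left (p : M) (Y : Π p : M, TangentSpace I p)
    (_hY : MDiffAt (T% Y) p) : TensorialAt I E (S.nijenhuisFun p · Y) p where
  smul {f X} hf hX := by
    simp only [nijenhuisFun, phiField_smul, etaField_smul]
    rw [mlieBracket_smul_left hf (S.mdiffAt_phiField hX), mlieBracket_smul_left hf hX,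
      mlieBracket_smul_left hf (S.mdiffAt_phiField hX), mlieBracket_smul_left hf hX,
      mvfderiv_mul hf (S.mdiffAt_etaField hX)]
    simp [phiField, etaField, S.phi_phi]
    module
  add {X X'} hX hX' := by
    simp only [nijenhuisFun, phiField_add, etaField_add]
    rw [mlieBracket_add_left (S.mdiffAt_phiField hX) (S.mdiffAt_phiField hX'),
      mlieBracket_add_left hX hX',
      mlieBracket_add_left (S.mdiffAt_phiField hX) (S.mdiffAt_phiField hX'),
      mlieBracket_add_left hX hX',
      mvfderiv_add (S.mdiffAt_etaField hX) (S.mdiffAt_etaField hX')]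
    simp
    module

lemma nijenhuis_tensorial_right (p : M) (X : Π p : M, TangentSpace I p)
    (hX : MDiffAt (T% X) p) : TensorialAt I E (S.nijenhuisFun p X ·) p where
  smul {f Y} hf hY := by
    simp only [S.nijenhuisFun_swap p X]
    rw [(S.nijenhuis_tensorial_left p X hX).smul hf hY, smul_neg]
  add {Y Y'} hY hY' := by
    simp only [S.nijenhuisFun_swap p X]
    rw [(S.nijenhuis_tensorial_left p X hX).add hY hY', neg_add]

/-- The Nijenhuis tensor `N = [φ, φ] + dη ⊗ ξ`. -/
def nijenhuis (p : M) : TangentSpace I p →L[ℝ] TangentSpace I p →L[ℝ] TangentSpace I p :=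
  TensorialAt.mkHom₂ (F := E) (F' := E) (S.nijenhuisFun p) p
    (S.nijenhuis_tensorial_left p) (S.nijenhuis_tensorial_right p)

/-- The tensor `N(x, y, z) = g(N(x, y), z)`. -/
def nijenhuis3 (p : M) (x y z : TangentSpace I p) : ℝ := S.g p (S.nijenhuis p x y) z

/-! The `φ`-canonical connection. -/

/-- The Levi-Civita connection of the B-metric. -/
abbrev nabla : CovariantDerivative I E (fun p : M ↦ TangentSpace I p) := S.metric.leviCivita

/-- The difference tensor of the `φB`-connection and the Levi-Civita connection:
`Q⁰(x, y) = ½{(∇_x φ) φy + (∇_x η)(y) ξ} - η(y) ∇_x ξ`. -/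
def Qzero (p : M) (x y : TangentSpace I p) : TangentSpace I p :=
  (1 / 2 : ℝ) • (S.nablaPhi S.nabla p x (S.phi p y) + S.nablaEta S.nabla p x y • S.xi p)
  - S.eta p y • S.nabla S.xi p x

/-- The tensor
`Q'(x, y, z) = Q⁰(x, y, z) - ⅛{N(φ²z, φ²y, φ²x) + 2 N(φz, φy, ξ) η(x)}`. -/
def Qprime (p : M) (x y z : TangentSpace I p) : ℝ :=
  S.g p (S.Qzero p x y) z
  - (1 / 8 : ℝ) *
    (S.nijenhuis3 p (S.phi p (S.phi p z)) (S.phi p (S.phi p y)) (S.phi p (S.phi p x))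
      + 2 * S.nijenhuis3 p (S.phi p z) (S.phi p y) (S.xi p) * S.eta p x)

/-- The covector `z ↦ Q'(x, y, z)`. -/
def QprimeCovector (p : M) (x y : TangentSpace I p) : TangentSpace I p →L[ℝ] ℝ :=
  LinearMap.toContinuousLinearMap
    { toFun := S.Qprime p x y
      map_add' := fun z z' ↦ by simp [Qprime, nijenhuis3, g]; ring
      map_smul' := fun c z ↦ by simp [Qprime, nijenhuis3, g]; ring }

/-- The tensor determined by `g(A(y)(x), z) = Q'(x, y, z)`. -/
def canonicalTensor (p : M) :
    TangentSpace I p →L[ℝ] TangentSpace I p →L[ℝ] TangentSpace I p :=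
  (LinearMap.mk₂ ℝ (fun y x ↦ S.metric.sharp p (S.QprimeCovector p x y))
    (fun y y' x ↦ by
      rw [← map_add]; congr 1; ext z
      simp [QprimeCovector, Qprime, Qzero, nablaPhi, nablaEta, nijenhuis3, g]; ring)
    (fun c y x ↦ by
      rw [← map_smul]; congr 1; ext z
      simp [QprimeCovector, Qprime, Qzero, nablaPhi, nablaEta, nijenhuis3, g]; ring)
    (fun y x x' ↦ by
      rw [← map_add]; congr 1; ext z
      simp [QprimeCovector, Qprime, Qzero, nablaPhi, nablaEta, nijenhuis3, g]; ring)
    (fun c y x ↦ by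
      rw [← map_smul]; congr 1; ext z
      simp [QprimeCovector, Qprime, Qzero, nablaPhi, nablaEta, nijenhuis3, g]; ring)).toContinuousBilinearMap

/-- The `φ`-canonical connection `∇'`: `g(∇'_x y, z) = g(∇_x y, z) + Q'(x, y, z)`. -/
def phiCanonical : CovariantDerivative I E (fun p : M ↦ TangentSpace I p) :=
  S.nabla.addOneForm S.canonicalTensor

lemma g_phiCanonical (Y : Π p : M, TangentSpace I p) (p : M) (x z : TangentSpace I p) :
    S.g p (S.phiCanonical Y p x) z = S.g p (S.nabla Y p x) z + S.Qprime p x (Y p) z := by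
  have h : S.phiCanonical Y p x
      = S.nabla Y p x + S.metric.sharp p (S.QprimeCovector p x (Y p)) := rfl
  rw [h]
  simp [g, QprimeCovector]

/-! The group `G` of general contactly conformal transformations. -/

/-- `S'` is the image of `S` under the general contactly conformal transformation given by the
functions `u`, `v`, `w`. -/
structure IsContactlyConformal (S S' : AlmostContactBMetric I M) (u v w : M → ℝ) : Prop where
  phi_eq (p : M) : S'.phi p = S.phi p
  xi_eq (p : M) : S'.xi p = Real.exp (-w p) • S.xi p
  eta_eq (p : M) : S'.eta p = Real.exp (w p) • S.eta p
  metric_eq (p : M) (x y : TangentSpace I p) :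
    S'.g p x y
      = Real.exp (2 * u p) * Real.cos (2 * v p) * S.g p x y
        + Real.exp (2 * u p) * Real.sin (2 * v p) * S.g p x (S.phi p y)
        + (Real.exp (2 * w p) - Real.exp (2 * u p) * Real.cos (2 * v p))
          * (S.eta p x * S.eta p y)

end AlmostContactBMetric

end BMetric

end

noncomputable section

set_option linter.unusedSectionVars false

namespace BMetric

variable {E : Type*} [NormedAddCommGroup E] [NormedSpace ℝ E] [FiniteDimensional ℝ E]
  {H : Type*} [TopologicalSpace H] {I : ModelWithCorners ℝ E H}
  {M : Type*} [TopologicalSpace M] [ChartedSpace H M] [IsManifold I ∞ M]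

/-! ### Compatibility and symmetry of the Levi-Civita connection -/

namespace PseudoMetric

variable (g : PseudoMetric I M)

/-! The transformation law follows from a uniqueness principle, so the Levi-Civita connection and
the Nijenhuis tensor of the transformed metric never have to be related to the original ones. A
natural connection whose torsion satisfies the linear condition `HorizontalTorsion` is unique: the
difference C of two such connections commutes with φ, kills ξ and is skew for g, and the condition
becomes a homogeneous linear system for g(C(x,y),z) with only the zero solution
(`eq_zero_of_horizontalTorsion`).

The connection ∇' satisfies both requirements. Naturality comes from Q⁰; the Nijenhuis part of Q' is
skew, φ-balanced and killed by ξ, so it preserves naturality, and its coefficients are exactly those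
that cancel the torsion defect (`isNatural_phiCanonical`, `horizontalTorsion_phiCanonical`).

The right-hand side of the asserted formula is also a connection, ∇' plus a tensor. It is natural
for the transformed structure, because its terms outside the bracket absorb the derivatives of the
conformal factors and the bracket is skew (`IsContactlyConformal.isNatural`). It satisfies the
torsion condition of S, and that condition passes to S' (`horizontalTorsion_conformalFun`,
`IsContactlyConformal.horizontalTorsion`). Uniqueness identifies it with the canonical connection of
S'; antisymmetrizing gives the torsion formula.

The torsion identity in the definition of a φ-canonical connection is vacuous at x = ξ. Uniqueness
therefore uses the stronger `HorizontalTorsion`, which keeps that component. -/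

lemma ext_form {p : M} {v w : TangentSpace I p} (h : ∀ z, g.form p v z = g.form p w z) : v = w :=
  g.flat_injective p (ContinuousLinearMap.ext h)

lemma leviCivita_koszul {Y X Z : Π p : M, TangentSpace I p} {p : M} (hY : MDiffAt (T% Y) p)
    (hX : MDiffAt (T% X) p) (hZ : MDiffAt (T% Z) p) :
    2 * g.form p (g.leviCivita Y p (X p)) (Z p) = g.koszul Y X Z p :=
  g.koszul_formula hY hX hZ

lemma leviCivita_metric {Y Z : Π p : M, TangentSpace I p} {p : M} (hY : MDiffAt (T% Y) p)
    (hZ : MDiffAt (T% Z) p) (x : TangentSpace I p) :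
    mvfderiv I (fun q ↦ g.form q (Y q) (Z q)) p x
      = g.form p (g.leviCivita Y p x) (Z p) + g.form p (Y p) (g.leviCivita Z p x) := by
  have hx := mdifferentiableAt_extend I E x
  have h1 := g.leviCivita_koszul hY hx hZ
  have h2 := g.leviCivita_koszul hZ hx hY
  have h3 : (fun q ↦ g.form q (Z q) (Y q)) = fun q ↦ g.form q (Y q) (Z q) :=
    funext fun q ↦ g.symm q _ _
  simp only [koszul, extend_apply_self, h3] at h1 h2
  rw [mlieBracket_swap_apply (V := Z) (W := Y), mlieBracket_swap_apply (V := Z) (W := extend E x)]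
    at h1
  rw [mlieBracket_swap_apply (V := Y) (W := extend E x)] at h2
  simp only [map_neg, neg_apply] at h1 h2
  rw [g.symm p (Y p)]
  linarith

lemma leviCivita_torsion (p : M) (x y : TangentSpace I p) : g.leviCivita.torsion p x y = 0 := by
  have hx := mdifferentiableAt_extend I E x
  have hy := mdifferentiableAt_extend I E y
  rw [g.leviCivita.torsion_apply_eq_extend]
  refine g.ext_form fun z ↦ ?_
  have hz := mdifferentiableAt_extend I E z
  have h1 := g.leviCivita_koszul hy hx hz
  have h2 := g.leviCivita_koszul hx hy hz
  have h3 : (fun q ↦ g.form q (extend E y q) (extend E x q))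
      = fun q ↦ g.form q (extend E x q) (extend E y q) :=
    funext fun q ↦ g.symm q _ _
  simp only [koszul, h3] at h1 h2
  rw [mlieBracket_swap_apply (V := extend E y) (W := extend E x)] at h2
  simp only [map_neg, neg_apply, map_sub, map_zero, sub_apply, zero_apply, extend_apply_self]
    at h1 h2 ⊢
  linarith

lemma mlieBracket_eq_leviCivita {X Y : Π p : M, TangentSpace I p} {p : M}
    (hX : MDiffAt (T% X) p) (hY : MDiffAt (T% Y) p) :
    mlieBracket I X Y p = g.leviCivita Y p (X p) - g.leviCivita X p (Y p) := by
  have h := g.leviCivita.torsion_apply hX hY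
  rw [g.leviCivita_torsion] at h
  exact (sub_eq_zero.mp h.symm).symm

end PseudoMetric

namespace AlmostContactBMetric

variable (S : AlmostContactBMetric I M)

/-! ### Pointwise identities for the structure tensors -/

lemma g_symm (p : M) (v w : TangentSpace I p) : S.g p v w = S.g p w v := S.metric.symm p v w

lemma g_xi (p : M) (v : TangentSpace I p) : S.g p v (S.xi p) = S.eta p v := by
  have h := S.metric_phi p v (S.xi p)
  rw [S.phi_xi, S.eta_xi, map_zero] at h
  simp only [g]
  linarith

lemma xi_g (p : M) (v : TangentSpace I p) : S.g p (S.xi p) v = S.eta p v := by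
  rw [g_symm, g_xi]

/-- Put φw for w in the compatibility of φ and g; then φ² = -Id + η⊗ξ applies, and the η-terms die
because η∘φ = 0. -/
lemma g_phi_left (p : M) (v w : TangentSpace I p) : S.g p (S.phi p v) w = S.g p v (S.phi p w) := by
  have h := S.metric_phi p v (S.phi p w)
  have h' := S.g_xi p (S.phi p v)
  rw [S.eta_phi] at h'
  simp only [g] at h' ⊢
  rw [S.phi_phi, S.eta_phi, map_add, map_neg, map_smul, h'] at h
  simp at h
  linarith

/-- The splitting TM = ker η ⊕ ℝξ: the horizontal part of v is -φ²v. Later statements are proved on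
ker η and at ξ, then extended by it. -/
lemma eq_phi_phi (p : M) (v : TangentSpace I p) :
    v = -S.phi p (S.phi p v) + S.eta p v • S.xi p := by
  rw [S.phi_phi]; module

lemma mdiffAt_xi (p : M) : MDiffAt (T% S.xi) p := S.smooth_xi.mdifferentiable (by simp) p

/-! ### Derivatives of the structure equations -/

section Nabla

variable (D : CovariantDerivative I E (fun p : M ↦ TangentSpace I p))

lemma nablaPhi_apply {Y : Π p : M, TangentSpace I p} {p : M} (hY : MDiffAt (T% Y) p)
    (x : TangentSpace I p) :
    S.nablaPhi D p x (Y p) = D (S.phiField Y) p x - S.phi p (D Y p x) := by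
  simp only [nablaPhi, nablaPhiTensor]
  rw [TensorialAt.mkHom_apply _ hY]
  rfl

lemma nablaEta_apply {Y : Π p : M, TangentSpace I p} {p : M} (hY : MDiffAt (T% Y) p)
    (x : TangentSpace I p) :
    S.nablaEta D p x (Y p) = mvfderiv I (S.etaField Y) p x - S.eta p (D Y p x) := by
  simp only [nablaEta, nablaEtaTensor]
  rw [TensorialAt.mkHom_apply _ hY]
  rfl

/-- Differentiate φ² = -Id + η⊗ξ. -/
lemma nablaPhi_phi (p : M) (x y : TangentSpace I p) :
    S.nablaPhi D p x (S.phi p y)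
      = -S.phi p (S.nablaPhi D p x y) + S.nablaEta D p x y • S.xi p + S.eta p y • D S.xi p x := by
  have hy := mdifferentiableAt_extend I E y
  have h1 := S.nablaPhi_apply D hy x
  have h2 := S.nablaPhi_apply D (S.mdiffAt_phiField hy) x
  have h3 := S.nablaEta_apply D hy x
  have h4 : S.phiField (S.phiField (extend E y))
      = (fun _ : M ↦ (-1 : ℝ)) • extend E y + S.etaField (extend E y) • S.xi := by
    ext q
    simp [phiField, etaField, S.phi_phi]
  have h5 : MDiffAt (fun _ : M ↦ (-1 : ℝ)) p := mdifferentiableAt_const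
  rw [h4, D.isCovariantDerivativeOn.add (h5.smul_section hy)
    ((S.mdiffAt_etaField hy).smul_section (S.mdiffAt_xi p)),
    D.isCovariantDerivativeOn.leibniz hy h5,
    D.isCovariantDerivativeOn.leibniz (S.mdiffAt_xi p) (S.mdiffAt_etaField hy),
    mvfderiv_const] at h2
  simp only [extend_apply_self, phiField, etaField] at h1 h2 h3
  rw [h2, h1, h3]
  simp [S.phi_phi]
  module

end Nabla

/-! ### Levi-Civita derivatives of ξ, η, φ and the Nijenhuis tensor -/

lemma eta_nabla_xi (p : M) (x : TangentSpace I p) : S.eta p (S.nabla S.xi p x) = 0 := by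
  have h := S.metric.leviCivita_metric (S.mdiffAt_xi p) (S.mdiffAt_xi p) x
  have h' : (fun q ↦ S.metric.form q (S.xi q) (S.xi q)) = fun _ ↦ (1 : ℝ) :=
    funext fun q ↦ (S.g_xi q _).trans (S.eta_xi q)
  have h1 := S.g_xi p (S.nabla S.xi p x)
  have h2 := S.xi_g p (S.nabla S.xi p x)
  rw [h', mvfderiv_const] at h
  simp only [g, nabla, zero_apply] at h h1 h2 ⊢
  linarith

lemma nablaEta_eq (p : M) (x y : TangentSpace I p) :
    S.nablaEta S.nabla p x y = S.g p (S.nabla S.xi p x) y := by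
  have hy := mdifferentiableAt_extend I E y
  have h := S.metric.leviCivita_metric hy (S.mdiffAt_xi p) x
  have h' : (fun q ↦ S.metric.form q (extend E y q) (S.xi q)) = S.etaField (extend E y) :=
    funext fun q ↦ S.g_xi q _
  have h1 := S.nablaEta_apply S.nabla hy x
  have h2 := S.g_xi p (S.nabla (extend E y) p x)
  have h3 := S.g_symm p (S.nabla S.xi p x) y
  simp only [extend_apply_self, g, nabla, h'] at h h1 h2 h3 ⊢
  linarith

/-- Differentiate the self-adjointness of φ. -/
lemma nablaPhi_symm (p : M) (x y z : TangentSpace I p) :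
    S.g p (S.nablaPhi S.nabla p x y) z = S.g p (S.nablaPhi S.nabla p x z) y := by
  have hy := mdifferentiableAt_extend I E y
  have hz := mdifferentiableAt_extend I E z
  have h1 := S.metric.leviCivita_metric (S.mdiffAt_phiField hy) hz x
  have h2 := S.metric.leviCivita_metric (S.mdiffAt_phiField hz) hy x
  have h' : (fun q ↦ S.metric.form q (S.phiField (extend E z) q) (extend E y q))
      = fun q ↦ S.metric.form q (S.phiField (extend E y) q) (extend E z q) :=
    funext fun q ↦ (S.g_phi_left q _ _).trans (S.g_symm q _ _)
  have h3 := S.nablaPhi_apply S.nabla hy x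
  have h4 := S.nablaPhi_apply S.nabla hz x
  have h5 := S.g_phi_left p (S.nabla (extend E y) p x) z
  have h6 := S.g_phi_left p (S.nabla (extend E z) p x) y
  have h7 := S.g_symm p (S.nabla (extend E y) p x) (S.phi p z)
  have h8 := S.g_symm p (S.nabla (extend E z) p x) (S.phi p y)
  rw [h'] at h2
  simp only [extend_apply_self, g, nabla, phiField] at h1 h2 h3 h4 h5 h6 h7 h8 ⊢
  rw [h3, h4]
  simp only [map_sub, sub_apply]
  linarith

lemma nablaPhi_xi (p : M) (x : TangentSpace I p) :
    S.nablaPhi S.nabla p x (S.xi p) = -S.phi p (S.nabla S.xi p x) := by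
  have h := S.nablaPhi_apply S.nabla (S.mdiffAt_xi p) x
  have h' : S.phiField S.xi = 0 := funext fun q ↦ S.phi_xi q
  rw [h, h', S.nabla.zero]
  simp

/-- Since ∇ is torsion-free, each bracket is a difference of covariant derivatives; the
second-argument terms then regroup into ∇φ and ∇η. -/
lemma nijenhuis_eq (p : M) (x y : TangentSpace I p) :
    S.nijenhuis p x y
      = S.nablaPhi S.nabla p (S.phi p x) y - S.nablaPhi S.nabla p (S.phi p y) x
        + S.phi p (S.nablaPhi S.nabla p y x) - S.phi p (S.nablaPhi S.nabla p x y)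
        + (S.nablaEta S.nabla p x y - S.nablaEta S.nabla p y x) • S.xi p := by
  have hx := mdifferentiableAt_extend I E x
  have hy := mdifferentiableAt_extend I E y
  have hφx := S.mdiffAt_phiField hx
  have hφy := S.mdiffAt_phiField hy
  have h : S.nijenhuis p x y = S.nijenhuisFun p (extend E x) (extend E y) :=
    TensorialAt.mkHom₂_apply_eq_extend (S.nijenhuis_tensorial_left p)
      (S.nijenhuis_tensorial_right p) x y
  have h1 := S.nablaPhi_apply S.nabla hy (S.phi p x)
  have h2 := S.nablaPhi_apply S.nabla hx (S.phi p y)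
  have h3 := S.nablaPhi_apply S.nabla hx y
  have h4 := S.nablaPhi_apply S.nabla hy x
  have h5 := S.nablaEta_apply S.nabla hy x
  have h6 := S.nablaEta_apply S.nabla hx y
  rw [h, nijenhuisFun, S.metric.mlieBracket_eq_leviCivita hφx hφy,
    S.metric.mlieBracket_eq_leviCivita hx hy,
    S.metric.mlieBracket_eq_leviCivita hφx hy, S.metric.mlieBracket_eq_leviCivita hx hφy]
  simp only [phiField, extend_apply_self] at h1 h2 h3 h4 h5 h6 ⊢
  rw [h1, h2, h3, h4, h5, h6]
  simp only [map_sub]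
  module

/-! ### Algebra of the Nijenhuis tensor -/

lemma eta_nablaPhi (p : M) (x y : TangentSpace I p) :
    S.eta p (S.nablaPhi S.nabla p x y) = -S.g p (S.nabla S.xi p x) (S.phi p y) := by
  rw [← S.g_xi, S.nablaPhi_symm, S.nablaPhi_xi, ← S.g_phi_left]
  simp [g]

lemma nablaPhi_neg_left (D : CovariantDerivative I E (fun p : M ↦ TangentSpace I p)) (p : M)
    (x y : TangentSpace I p) : S.nablaPhi D p (-x) y = -S.nablaPhi D p x y := by
  simp [nablaPhi]

lemma nijenhuis_swap (p : M) (x y : TangentSpace I p) :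
    S.nijenhuis p x y = -S.nijenhuis p y x := by
  rw [S.nijenhuis_eq p x y, S.nijenhuis_eq p y x]
  module

lemma nijenhuis_phi_left {p : M} {x y : TangentSpace I p} (hx : S.eta p x = 0)
    (hy : S.eta p y = 0) : S.nijenhuis p (S.phi p x) y = S.nijenhuis p x (S.phi p y) := by
  rw [S.nijenhuis_eq, S.nijenhuis_eq]
  have h1 := S.g_phi_left p (S.nabla S.xi p y) x
  simp only [S.nablaPhi_phi, S.phi_phi, S.nablaEta_eq, hx, hy, zero_smul, add_zero,
    S.nablaPhi_neg_left, map_add, map_neg, map_smul, S.phi_xi, S.eta_nablaPhi, g]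
  module

/-- Up to a multiple of ξ, N(φx, y) = -φN(x, y) for horizontal x. -/
lemma phi_nijenhuis_phi_left {p : M} {x : TangentSpace I p} (hx : S.eta p x = 0)
    (y : TangentSpace I p) : S.phi p (S.nijenhuis p (S.phi p x) y)
      = S.nijenhuis p x y - S.eta p (S.nijenhuis p x y) • S.xi p := by
  rw [S.nijenhuis_eq, S.nijenhuis_eq]
  simp only [S.nablaPhi_phi, S.phi_phi, S.nablaEta_eq, hx, zero_smul, add_zero, S.eta_phi,
    S.nablaPhi_neg_left, map_add, map_neg, map_smul, map_sub, S.phi_xi, S.eta_xi, S.eta_nablaPhi,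
    smul_zero, g, smul_eq_mul]
  module

lemma eta_nijenhuis {p : M} (x y : TangentSpace I p) :
    S.eta p (S.nijenhuis p x y)
      = S.g p (S.nabla S.xi p x) y - S.g p (S.nabla S.xi p y) x
        - S.g p (S.nabla S.xi p (S.phi p x)) (S.phi p y)
        + S.g p (S.nabla S.xi p (S.phi p y)) (S.phi p x) := by
  rw [S.nijenhuis_eq]
  simp only [S.nablaEta_eq, S.eta_phi, map_add, map_smul, map_sub, S.eta_xi, S.eta_nablaPhi,
    smul_eq_mul]
  ring

lemma nijenhuis3_swap (p : M) (x y z : TangentSpace I p) :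
    S.nijenhuis3 p x y z = -S.nijenhuis3 p y x z := by
  rw [nijenhuis3, S.nijenhuis_swap]
  simp [nijenhuis3, g]

lemma nijenhuis3_phi_left {p : M} {x y : TangentSpace I p} (z : TangentSpace I p)
    (hx : S.eta p x = 0) (hy : S.eta p y = 0) :
    S.nijenhuis3 p (S.phi p x) y z = S.nijenhuis3 p x (S.phi p y) z := by
  rw [nijenhuis3, S.nijenhuis_phi_left hx hy, nijenhuis3]

lemma nijenhuis3_phi_phi {p : M} {x y z : TangentSpace I p}
    (hx : S.eta p x = 0) (hz : S.eta p z = 0) :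
    S.nijenhuis3 p (S.phi p x) y (S.phi p z) = S.nijenhuis3 p x y z := by
  rw [nijenhuis3, ← S.g_phi_left, S.phi_nijenhuis_phi_left hx y, nijenhuis3]
  have h := S.xi_g p z
  simp only [g] at h
  simp [h, hz, g]

lemma nijenhuis3_eq {p : M} {x y z : TangentSpace I p} (hz : S.eta p z = 0) :
    S.nijenhuis3 p x y z
      = S.g p (S.nablaPhi S.nabla p (S.phi p x) y) z - S.g p (S.nablaPhi S.nabla p (S.phi p y) x) z
        + S.g p (S.nablaPhi S.nabla p y x) (S.phi p z)
        - S.g p (S.nablaPhi S.nabla p x y) (S.phi p z) := by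
  have h := S.xi_g p z
  simp only [← S.g_phi_left]
  rw [nijenhuis3, S.nijenhuis_eq]
  simp only [g, map_add, map_smul, map_sub, add_apply, sub_apply, smul_apply, smul_eq_mul] at h ⊢
  rw [h, hz]
  ring

/-! ### The `φ`-canonical connection is natural -/

lemma g_Qzero (p : M) (x y z : TangentSpace I p) :
    S.g p (S.Qzero p x y) z
      = (1 / 2) * S.g p (S.nablaPhi S.nabla p x (S.phi p y)) z
        + (1 / 2) * (S.g p (S.nabla S.xi p x) y * S.eta p z)
        - S.eta p y * S.g p (S.nabla S.xi p x) z := by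
  have h := S.xi_g p z
  rw [Qzero, S.nablaEta_eq]
  simp only [g, map_add, map_smul, map_sub, add_apply, sub_apply, smul_apply, smul_eq_mul] at h ⊢
  rw [h]
  ring

lemma g_nablaPhi_phi (p : M) (x y z : TangentSpace I p) :
    S.g p (S.nablaPhi S.nabla p x (S.phi p y)) z
      = -S.g p (S.nablaPhi S.nabla p x y) (S.phi p z)
        + S.g p (S.nabla S.xi p x) y * S.eta p z + S.eta p y * S.g p (S.nabla S.xi p x) z := by
  have h := S.xi_g p z
  rw [S.nablaPhi_phi, S.nablaEta_eq, ← S.g_phi_left]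
  simp only [g, map_add, map_smul, map_neg, neg_apply, add_apply, smul_apply, smul_eq_mul] at h ⊢
  rw [h]

lemma g_nablaPhi_xi (p : M) (x z : TangentSpace I p) :
    S.g p (S.nablaPhi S.nabla p x (S.xi p)) z = -S.g p (S.nabla S.xi p x) (S.phi p z) := by
  rw [S.nablaPhi_xi, ← S.g_phi_left]
  simp [g]

lemma Qprime_xi (p : M) (x z : TangentSpace I p) :
    S.Qprime p x (S.xi p) z = -S.g p (S.nabla S.xi p x) z := by
  rw [Qprime, g_Qzero, nijenhuis3, nijenhuis3, S.phi_xi, map_zero, S.eta_xi, S.g_xi,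
    S.eta_nabla_xi]
  simp [nablaPhi, g]

/-- This is ∇'φ = 0 in terms of Q'. The Nijenhuis terms agree on both sides because φ moves freely
between the first two slots of N on ker η; only Q⁰ produces ∇φ. -/
lemma Qprime_phi (p : M) (x y z : TangentSpace I p) :
    S.Qprime p x (S.phi p y) z
      = S.Qprime p x y (S.phi p z) - S.g p (S.nablaPhi S.nabla p x y) z := by
  have h1 := S.nijenhuis3_phi_left (S.phi p (S.phi p x)) (S.eta_phi p (S.phi p z))
    (S.eta_phi p (S.phi p y))
  have h2 := S.nijenhuis3_phi_left (S.xi p) (S.eta_phi p z) (S.eta_phi p y)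
  have h3 := S.g_nablaPhi_phi p x y (S.phi p z)
  have h4 : S.g p (S.nablaPhi S.nabla p x (S.phi p (S.phi p y))) z
      = -S.g p (S.nablaPhi S.nabla p x y) z + S.eta p y * -S.g p (S.nabla S.xi p x) (S.phi p z) := by
    rw [← S.g_nablaPhi_xi, S.phi_phi]
    simp [nablaPhi, g]
  have h5 : S.g p (S.nablaPhi S.nabla p x y) (S.phi p (S.phi p z))
      = -S.g p (S.nablaPhi S.nabla p x y) z
        + S.eta p z * -S.g p (S.nabla S.xi p x) (S.phi p y) := by
    have h := S.g_xi p (S.nablaPhi S.nabla p x y)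
    rw [← S.eta_nablaPhi, S.phi_phi]
    simp only [g, map_add, map_neg, map_smul, smul_eq_mul] at h ⊢
    rw [h]
  rw [Qprime, Qprime, g_Qzero, g_Qzero, ← h1, ← h2, h3, h4, h5]
  simp only [S.eta_phi]
  ring

lemma Qprime_swap (p : M) (x y z : TangentSpace I p) :
    S.Qprime p x y z = -S.Qprime p x z y := by
  have h1 := S.nijenhuis3_swap p (S.phi p (S.phi p z)) (S.phi p (S.phi p y)) (S.phi p (S.phi p x))
  have h2 := S.nijenhuis3_swap p (S.phi p z) (S.phi p y) (S.xi p)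
  have h3 := S.g_nablaPhi_phi p x y z
  have h4 := S.nablaPhi_symm p x (S.phi p z) y
  rw [Qprime, Qprime, g_Qzero, g_Qzero, h1, h2, h4, h3]
  ring

lemma Qprime_right_xi (p : M) (x y : TangentSpace I p) :
    S.Qprime p x y (S.xi p) = S.g p (S.nabla S.xi p x) y := by
  rw [Qprime_swap, Qprime_xi, neg_neg]

lemma g_canonicalTensor (p : M) (x y z : TangentSpace I p) :
    S.g p (S.canonicalTensor p y x) z = S.Qprime p x y z := by
  have h : S.canonicalTensor p y x = S.metric.sharp p (S.QprimeCovector p x y) := rfl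
  rw [h]
  simp [g, QprimeCovector]

lemma phiCanonical_apply (Y : Π p : M, TangentSpace I p) (p : M) (x : TangentSpace I p) :
    S.phiCanonical Y p x = S.nabla Y p x + S.canonicalTensor p (Y p) x := rfl

lemma isNatural_phiCanonical : S.IsNatural S.phiCanonical where
  phi_parallel p x y := by
    have hy := mdifferentiableAt_extend I E y
    have h1 := S.nablaPhi_apply S.phiCanonical hy x
    have h2 := S.nablaPhi_apply S.nabla hy x
    rw [extend_apply_self] at h1 h2
    rw [h1, phiCanonical_apply, phiCanonical_apply, map_add, extend_apply_self, phiField,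
      extend_apply_self]
    refine S.metric.ext_form fun z ↦ ?_
    have h3 := S.Qprime_phi p x y z
    rw [h2, ← S.g_canonicalTensor, ← S.g_canonicalTensor, ← S.g_phi_left] at h3
    simp only [g, map_add, map_sub, add_apply, sub_apply, map_zero, zero_apply] at h3 ⊢
    linarith
  xi_parallel p x := by
    refine S.metric.ext_form fun z ↦ ?_
    have h := S.g_phiCanonical S.xi p x z
    rw [S.Qprime_xi] at h
    simpa [g] using h
  eta_parallel p x y := by
    have hy := mdifferentiableAt_extend I E y
    have h1 := S.nablaEta_apply S.phiCanonical hy x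
    have h2 := S.nablaEta_apply S.nabla hy x
    have h3 := S.Qprime_right_xi p x y
    rw [extend_apply_self] at h1 h2
    rw [← S.g_canonicalTensor, S.g_xi, ← S.nablaEta_eq] at h3
    rw [h1, phiCanonical_apply, map_add, extend_apply_self]
    linarith
  metric_parallel p Y Z x hY hZ := by
    have h1 := S.metric.leviCivita_metric hY hZ x
    have h2 := S.Qprime_swap p x (Y p) (Z p)
    rw [S.g_symm p (Y p), S.g_phiCanonical, S.g_phiCanonical, h2, h1, S.metric.symm p (Y p)]
    simp only [g, nabla]
    ring

/-! ### Torsion of the `φ`-canonical connection -/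

lemma torsion3_phiCanonical (p : M) (x y z : TangentSpace I p) :
    S.torsion3 S.phiCanonical p x y z = S.Qprime p x y z - S.Qprime p y x z := by
  have h : S.phiCanonical.torsion p x y = S.canonicalTensor p y x - S.canonicalTensor p x y := by
    have h' := S.metric.leviCivita_torsion p x y
    rw [CovariantDerivative.torsion_apply_eq_extend] at h' ⊢
    simp only [phiCanonical_apply, extend_apply_self] at h' ⊢
    rw [← sub_eq_zero] at h' ⊢
    rw [← h']
    abel
  rw [torsion3, h, ← S.g_canonicalTensor, ← S.g_canonicalTensor]
  simp [g]

/-- The condition on the torsion which together with naturality characterizes the `φ`-canonical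
connection: on `ker η`, the skew-symmetrization of `T(x, y, z) - T(x, φy, φz)` in `y, z` vanishes
for all `x`, including `x = ξ`. -/
def HorizontalTorsion (p : M) (T : TangentSpace I p → TangentSpace I p → TangentSpace I p) :
    Prop :=
  ∀ x y z : TangentSpace I p, S.eta p y = 0 → S.eta p z = 0 →
    S.g p (T x y) z - S.g p (T x (S.phi p y)) (S.phi p z)
      - (S.g p (T x z) y - S.g p (T x (S.phi p z)) (S.phi p y)) = 0

lemma phi_phi_of_eta_eq_zero {p : M} {v : TangentSpace I p} (hv : S.eta p v = 0) :
    S.phi p (S.phi p v) = -v := by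
  rw [S.phi_phi, hv]; simp

lemma Qprime_of_eta_eq_zero {p : M} {x y z : TangentSpace I p} (hx : S.eta p x = 0)
    (hy : S.eta p y = 0) (hz : S.eta p z = 0) :
    S.Qprime p x y z = -(1 / 2) * S.g p (S.nablaPhi S.nabla p x y) (S.phi p z)
      + (1 / 8) * S.nijenhuis3 p z y x := by
  rw [Qprime, g_Qzero, g_nablaPhi_phi, S.phi_phi_of_eta_eq_zero hx, S.phi_phi_of_eta_eq_zero hy,
    S.phi_phi_of_eta_eq_zero hz, hx, hy, hz]
  simp only [nijenhuis3, g, map_neg, neg_apply]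
  ring

lemma nijenhuis3_phi_phi_left {p : M} {x y : TangentSpace I p} (z : TangentSpace I p)
    (hx : S.eta p x = 0) (hy : S.eta p y = 0) :
    S.nijenhuis3 p (S.phi p x) (S.phi p y) z = -S.nijenhuis3 p x y z := by
  rw [← S.nijenhuis3_phi_left z (S.eta_phi p x) hy, S.phi_phi_of_eta_eq_zero hx]
  simp [nijenhuis3, g]

lemma g_nablaPhi_phi_phi {p : M} {x y z : TangentSpace I p} (hy : S.eta p y = 0)
    (hz : S.eta p z = 0) :
    S.g p (S.nablaPhi S.nabla p x (S.phi p y)) (S.phi p (S.phi p z))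
      = S.g p (S.nablaPhi S.nabla p x y) (S.phi p z) := by
  have h := S.g_nablaPhi_phi p x y z
  rw [S.phi_phi_of_eta_eq_zero hz]
  rw [hy, hz] at h
  simp only [g, map_neg] at h ⊢
  linarith

/-- Write F(x,y,z) = g((∇_xφ)y, z). In Q'(x,y,z) - Q'(x,φy,φz) the F-terms cancel and N(z,y,x)/4
remains, so antisymmetrizing gives N(z,y,x)/2. In the part with x in the second slot the N-terms
cancel and the F-terms give minus half the expression of N in terms of F. This is what the
coefficient 1/8 is for. -/
lemma torsion3_phiCanonical_of_eta_eq_zero {p : M} {x y z : TangentSpace I p} (hx : S.eta p x = 0)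
    (hy : S.eta p y = 0) (hz : S.eta p z = 0) :
    S.torsion3 S.phiCanonical p x y z
      - S.torsion3 S.phiCanonical p x (S.phi p y) (S.phi p z)
      - (S.torsion3 S.phiCanonical p x z y
        - S.torsion3 S.phiCanonical p x (S.phi p z) (S.phi p y)) = 0 := by
  have hφy := S.eta_phi p y
  have hφz := S.eta_phi p z
  simp only [torsion3_phiCanonical]
  rw [S.Qprime_of_eta_eq_zero hx hy hz, S.Qprime_of_eta_eq_zero hy hx hz,
    S.Qprime_of_eta_eq_zero hx hφy hφz, S.Qprime_of_eta_eq_zero hφy hx hφz,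
    S.Qprime_of_eta_eq_zero hx hz hy, S.Qprime_of_eta_eq_zero hz hx hy,
    S.Qprime_of_eta_eq_zero hx hφz hφy, S.Qprime_of_eta_eq_zero hφz hx hφy,
    S.g_nablaPhi_phi_phi hy hz, S.g_nablaPhi_phi_phi hz hy,
    S.nijenhuis3_phi_phi_left x hz hy, S.nijenhuis3_phi_phi_left x hy hz,
    S.nijenhuis3_phi_phi hz hy, S.nijenhuis3_phi_phi hy hz,
    S.nijenhuis3_swap p y z x, S.nijenhuis3_eq hx (x := z) (y := y),
    S.phi_phi_of_eta_eq_zero hz, S.phi_phi_of_eta_eq_zero hy]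
  have h1 := S.nablaPhi_symm p (S.phi p y) x z
  have h2 := S.nablaPhi_symm p (S.phi p z) x y
  have h3 := S.g_nablaPhi_phi p x y z
  have h4 := S.nablaPhi_symm p x (S.phi p y) z
  have h5 := S.g_nablaPhi_phi p y z x
  have h6 := S.nablaPhi_symm p y (S.phi p z) x
  have h7 := S.g_nablaPhi_phi p z y x
  have h8 := S.nablaPhi_symm p z (S.phi p y) x
  rw [hy, hz] at h3
  rw [hx, hz] at h5
  rw [hx, hy] at h7
  simp only [g, map_neg] at h1 h2 h3 h4 h5 h6 h7 h8 ⊢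
  linarith

lemma torsion3_phiCanonical_xi {p : M} {y z : TangentSpace I p}
    (hy : S.eta p y = 0) (hz : S.eta p z = 0) :
    S.torsion3 S.phiCanonical p (S.xi p) y z
      - S.torsion3 S.phiCanonical p (S.xi p) (S.phi p y) (S.phi p z)
      - (S.torsion3 S.phiCanonical p (S.xi p) z y
        - S.torsion3 S.phiCanonical p (S.xi p) (S.phi p z) (S.phi p y)) = 0 := by
  have hN : S.nijenhuis3 p z y (S.xi p) = _ := (S.g_xi p _).trans (S.eta_nijenhuis z y)
  -- At x = ξ the first Nijenhuis term vanishes because φ²ξ = 0, and 1/4 is 2 · 1/8.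
  have hQ : ∀ {y z : TangentSpace I p}, S.eta p y = 0 → S.eta p z = 0 →
      S.Qprime p (S.xi p) y z
        = -(1 / 2) * S.g p (S.nablaPhi S.nabla p (S.xi p) y) (S.phi p z)
          + (1 / 4) * S.nijenhuis3 p z y (S.xi p) := by
    intro y z hy hz
    rw [Qprime, g_Qzero, g_nablaPhi_phi, S.phi_xi, S.nijenhuis3_phi_phi_left _ hz hy, hy, hz,
      S.eta_xi]
    simp only [nijenhuis3, g, map_zero]
    ring
  have hφy := S.eta_phi p y
  have hφz := S.eta_phi p z
  simp only [torsion3_phiCanonical]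
  rw [hQ hy hz, hQ hz hy, hQ hφy hφz, hQ hφz hφy, S.g_nablaPhi_phi_phi hy hz,
    S.g_nablaPhi_phi_phi hz hy, S.nijenhuis3_phi_phi_left _ hz hy,
    S.nijenhuis3_phi_phi_left _ hy hz, S.nijenhuis3_swap p y z, hN]
  simp only [Qprime_xi]
  ring

lemma torsion3_add_left (D : CovariantDerivative I E (fun p : M ↦ TangentSpace I p)) (p : M)
    (c : ℝ) (x x' y z : TangentSpace I p) :
    S.torsion3 D p (x + c • x') y z = S.torsion3 D p x y z + c * S.torsion3 D p x' y z := by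
  simp [torsion3, g]

lemma horizontalTorsion_phiCanonical (p : M) :
    S.HorizontalTorsion p (fun x y ↦ S.phiCanonical.torsion p x y) := by
  intro x y z hy hz
  have h1 := S.torsion3_phiCanonical_of_eta_eq_zero
    (x := -S.phi p (S.phi p x)) (by rw [map_neg, S.eta_phi, neg_zero]) hy hz
  have h2 := S.torsion3_phiCanonical_xi hy hz
  change S.torsion3 S.phiCanonical p x y z
      - S.torsion3 S.phiCanonical p x (S.phi p y) (S.phi p z)
      - (S.torsion3 S.phiCanonical p x z y
        - S.torsion3 S.phiCanonical p x (S.phi p z) (S.phi p y)) = 0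
  rw [S.eq_phi_phi p x]
  simp only [torsion3_add_left]
  linear_combination h1 + S.eta p x * h2

/-- The identity is the horizontal condition at x - η(x)ξ, y - η(y)ξ, z - η(z)ξ, expanded with the
antisymmetry of the torsion. -/
lemma torsion_identity_of_horizontalTorsion
    (D : CovariantDerivative I E (fun p : M ↦ TangentSpace I p)) {p : M}
    (hT : S.HorizontalTorsion p (fun x y ↦ D.torsion p x y)) (x y z : TangentSpace I p) :
    S.torsionExpr D p x y z - S.torsionExpr D p x z y = 0 := by
  have hη : ∀ v : TangentSpace I p, S.eta p (v - S.eta p v • S.xi p) = 0 := by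
    intro v
    rw [map_sub, map_smul, S.eta_xi, smul_eq_mul, mul_one, sub_self]
  have h1 := hT x _ _ (hη y) (hη z)
  have h2 := hT (S.xi p) _ _ (hη y) (hη z)
  have ha := D.torsion_antisymm x z (x := p)
  have hb := D.torsion_antisymm (S.xi p) z (x := p)
  have hc := D.torsion_antisymm (S.xi p) y (x := p)
  have hd := D.torsion_self (S.xi p) (x := p)
  simp only [torsionExpr, torsion3, g, map_sub, map_smul, S.phi_xi, smul_zero, sub_zero, sub_apply,
    smul_apply, smul_eq_mul, hb, hc, hd, map_neg, neg_apply] at h1 h2 ⊢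
  linear_combination h1 - S.eta p x * h2

lemma isPhiCanonical_phiCanonical : S.IsPhiCanonical S.phiCanonical where
  toIsNatural := S.isNatural_phiCanonical
  torsion_identity p x y z :=
    S.torsion_identity_of_horizontalTorsion _ (S.horizontalTorsion_phiCanonical p) x y z

/-! ### Uniqueness -/

/-- Write c(x,y,z) = g(C y x, z), with x the direction. The proof treats horizontal arguments first,
then the direction ξ, then the remaining ξ-components. -/
lemma eq_zero_of_horizontalTorsion {p : M}
    (C : TangentSpace I p →L[ℝ] TangentSpace I p →L[ℝ] TangentSpace I p)
    (hφ : ∀ x y, C (S.phi p y) x = S.phi p (C y x)) (hξ : ∀ x, C (S.xi p) x = 0)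
    (hg : ∀ x y z, S.g p (C y x) z = -S.g p (C z x) y)
    (hT : S.HorizontalTorsion p (fun x y ↦ C y x - C x y)) : C = 0 := by
  have hA : ∀ x y z, S.g p (C (S.phi p y) x) z = S.g p (C y x) (S.phi p z) := by
    intro x y z
    rw [hφ, S.g_phi_left]
  -- Since c(x,φy,φz) = -c(x,y,z) for horizontal z, the terms with direction x add up to 4c(x,y,z);
  -- the others are put in cyclic order by skewness.
  have hE : ∀ x y z, S.eta p y = 0 → S.eta p z = 0 →
      4 * S.g p (C y x) z + S.g p (C z y) x + S.g p (C x z) y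
        - S.g p (C (S.phi p z) (S.phi p y)) x - S.g p (C (S.phi p x) (S.phi p z)) y = 0 := by
    intro x y z hy hz
    have h := hT x y z hy hz
    have h1 := hA x y (S.phi p z)
    have h2 := hA x z (S.phi p y)
    have h3 := hA (S.phi p y) x z
    have h4 := hA (S.phi p z) x y
    have h5 := hg x y z
    have h6 := hg y x z
    have h7 := hg (S.phi p y) (S.phi p z) x
    have h8 := hA (S.phi p y) z x
    have h9 := hg (S.phi p y) z (S.phi p x)
    rw [S.phi_phi_of_eta_eq_zero hz] at h1
    rw [S.phi_phi_of_eta_eq_zero hy] at h2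
    simp only [g, map_sub, sub_apply, map_neg] at *
    linarith
  have hH : ∀ x y z, S.eta p x = 0 → S.eta p y = 0 → S.eta p z = 0 → S.g p (C y x) z = 0 := by
    intro x y z hx hy hz
    -- The same relation at (φx, φy, z). With its cyclic rotations and those of `hE` it closes into
    -- six equations in six unknowns: the rotations aᵢ of c(x,y,z) and bᵢ of c(φx,φy,z). Summing,
    -- 6Σa = 2Σb and 6Σb = 2Σa, so both sums vanish; then 3aᵢ + bᵢ = 0 = 3bᵢ + aᵢ.
    have key : ∀ x y z, S.eta p x = 0 → S.eta p y = 0 → S.eta p z = 0 →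
        4 * S.g p (C (S.phi p y) (S.phi p x)) z + S.g p (C (S.phi p z) (S.phi p y)) x
          + S.g p (C (S.phi p x) (S.phi p z)) y - S.g p (C z y) x - S.g p (C x z) y = 0 := by
      intro x y z hx hy hz
      have h := hE (S.phi p x) (S.phi p y) z (S.eta_phi p y) hz
      have h1 := hA (S.phi p y) z x
      have h2 := hA z x (S.phi p y)
      have h3 := hA y z (S.phi p x)
      have h4 := hA (S.phi p z) x y
      rw [S.phi_phi_of_eta_eq_zero hx] at h h3
      rw [S.phi_phi_of_eta_eq_zero hy] at h h2
      simp only [g, map_neg, neg_apply] at *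
      linarith
    have h1 := hE x y z hy hz
    have h2 := hE y z x hz hx
    have h3 := hE z x y hx hy
    have h4 := key x y z hx hy hz
    have h5 := key y z x hy hz hx
    have h6 := key z x y hz hx hy
    linarith
  have hG : ∀ x y z, S.eta p y = 0 → S.eta p z = 0 → S.g p (C y x) z = 0 := by
    intro x y z hy hz
    have h1 := hH (-S.phi p (S.phi p x)) y z (by rw [map_neg, S.eta_phi, neg_zero]) hy hz
    -- In direction ξ every term but 4c(ξ,y,z) contains ξ as an argument, hence vanishes by skewness
    -- and Cξ = 0.
    have h2 := hE (S.xi p) y z hy hz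
    have h3 := hg y z (S.xi p)
    have h4 := hg (S.phi p y) (S.phi p z) (S.xi p)
    rw [S.phi_xi] at h2
    rw [S.eq_phi_phi p x]
    simp only [g, hξ, map_zero, map_neg, map_add, map_smul, zero_apply, neg_apply, add_apply,
      smul_apply, smul_eq_mul] at h1 h2 h3 h4 ⊢
    rw [h3, h4] at h2
    linear_combination h1 + S.eta p x * h2 / 4
  ext y x
  refine S.metric.ext_form fun z ↦ ?_
  have h1 := hG x (-S.phi p (S.phi p y)) (-S.phi p (S.phi p z))
    (by rw [map_neg, S.eta_phi, neg_zero]) (by rw [map_neg, S.eta_phi, neg_zero])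
  have h2 := hg x (-S.phi p (S.phi p y)) (S.xi p)
  rw [S.eq_phi_phi p y, S.eq_phi_phi p z]
  simp only [g, hξ, map_zero, map_neg, map_add, map_smul, zero_apply, neg_apply, add_apply,
    smul_apply, smul_eq_mul] at h1 h2 ⊢
  linear_combination h1 + S.eta p z * h2

lemma IsNatural.eq_of_horizontalTorsion
    {D D' : CovariantDerivative I E (fun p : M ↦ TangentSpace I p)}
    (hD : S.IsNatural D) (hD' : S.IsNatural D') {p : M}
    (hT : S.HorizontalTorsion p (fun x y ↦ D.torsion p x y))
    (hT' : S.HorizontalTorsion p (fun x y ↦ D'.torsion p x y))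
    {Y : Π p : M, TangentSpace I p} (hY : MDiffAt (T% Y) p) (x : TangentSpace I p) :
    D Y p x = D' Y p x := by
  have hC : ∀ {Y : Π p : M, TangentSpace I p}, MDiffAt (T% Y) p → ∀ x,
      D.difference D' p (Y p) x = D Y p x - D' Y p x := fun hY x ↦ by
    rw [CovariantDerivative.difference, IsCovariantDerivativeOn.difference_apply _ _ (hσ := hY)]
    rfl
  suffices h : D.difference D' p = 0 by
    have h' := hC hY x
    rw [h] at h'
    exact sub_eq_zero.mp h'.symm
  refine S.eq_zero_of_horizontalTorsion _ (fun x y ↦ ?_) (fun x ↦ ?_) (fun x y z ↦ ?_) ?_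
  · have hy := mdifferentiableAt_extend I E y
    have h1 := hC (S.mdiffAt_phiField hy) x
    have h2 := hC hy x
    have h3 := S.nablaPhi_apply D hy x
    have h4 := S.nablaPhi_apply D' hy x
    rw [hD.phi_parallel] at h3
    rw [hD'.phi_parallel] at h4
    simp only [phiField, extend_apply_self] at h1 h2 h3 h4
    rw [h1, h2, map_sub, ← sub_eq_zero.mp h3.symm, ← sub_eq_zero.mp h4.symm]
  · rw [hC (S.mdiffAt_xi p), hD.xi_parallel, hD'.xi_parallel, sub_zero]
  · have hy := mdifferentiableAt_extend I E y
    have hz := mdifferentiableAt_extend I E z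
    have h1 := hC hy x
    have h2 := hC hz x
    have h3 := hD.metric_parallel p _ _ x hy hz
    have h4 := hD'.metric_parallel p _ _ x hy hz
    rw [S.g_symm p (extend E y p)] at h3 h4
    simp only [extend_apply_self, g] at h1 h2 h3 h4 ⊢
    rw [h1, h2, map_sub, map_sub, sub_apply, sub_apply]
    linarith
  · have h : ∀ x y, D.difference D' p y x - D.difference D' p x y
        = D.torsion p x y - D'.torsion p x y := by
      intro x y
      have hx := mdifferentiableAt_extend I E x
      have hy := mdifferentiableAt_extend I E y
      have h1 := hC hy x
      have h2 := hC hx y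
      simp only [D.torsion_apply_eq_extend, D'.torsion_apply_eq_extend, extend_apply_self]
        at h1 h2 ⊢
      rw [h1, h2]
      abel
    intro x y z hy hz
    have h1 := hT x y z hy hz
    have h2 := hT' x y z hy hz
    simp only [h, g, map_sub, sub_apply] at h1 h2 ⊢
    linarith

/-! ### The transformation of the `φ`-canonical connection -/

/-- The difference tensor of the `φ`-canonical connections under a general contactly conformal
transformation, as a function of the direction `x` and the argument `y`. -/
def conformalFun (u v w : M → ℝ) (a : M) (x y : TangentSpace I a) : TangentSpace I a :=
  -(mvfderiv I u a x • S.phi a (S.phi a y)) + mvfderiv I v a x • S.phi a y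
    + (mvfderiv I w a x * S.eta a y) • S.xi a
    + (1 / 2 : ℝ) •
      ((mvfderiv I u a (S.phi a (S.phi a y)) - mvfderiv I v a (S.phi a y)) • S.phi a (S.phi a x)
        - (mvfderiv I u a (S.phi a y) + mvfderiv I v a (S.phi a (S.phi a y))) • S.phi a x
        - S.g a (S.phi a x) (S.phi a y) •
          (S.phi a (S.phi a (S.metric.grad u a)) - S.phi a (S.metric.grad v a))
        + S.g a x (S.phi a y) •
          (S.phi a (S.metric.grad u a) + S.phi a (S.phi a (S.metric.grad v a))))

/-- The difference tensor `conformalFun` as a continuous bilinear map, argument first. -/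
def conformalTensor (u v w : M → ℝ) (a : M) :
    TangentSpace I a →L[ℝ] TangentSpace I a →L[ℝ] TangentSpace I a :=
  (LinearMap.mk₂ ℝ (fun y x ↦ S.conformalFun u v w a x y)
    (fun y y' x ↦ by simp only [conformalFun, g, map_add]; module)
    (fun c y x ↦ by simp only [conformalFun, g, map_smul, smul_eq_mul]; module)
    (fun y x x' ↦ by simp only [conformalFun, g, map_add, add_apply]; module)
    (fun c y x ↦ by
      simp only [conformalFun, g, map_smul, smul_apply, smul_eq_mul]; module)
    ).toContinuousBilinearMap

/-- The connection obtained by adding `conformalTensor` to the `φ`-canonical connection. -/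
def conformalConnection (u v w : M → ℝ) :
    CovariantDerivative I E (fun p : M ↦ TangentSpace I p) :=
  S.phiCanonical.addOneForm (S.conformalTensor u v w)

lemma conformalConnection_apply (u v w : M → ℝ) (Y : Π p : M, TangentSpace I p) (a : M)
    (x : TangentSpace I a) :
    S.conformalConnection u v w Y a x = S.phiCanonical Y a x + S.conformalFun u v w a x (Y a) := rfl

lemma conformalConnection_torsion (u v w : M → ℝ) (a : M) (x y : TangentSpace I a) :
    (S.conformalConnection u v w).torsion a x y = S.phiCanonical.torsion a x y
      + (S.conformalFun u v w a x y - S.conformalFun u v w a y x) := by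
  simp only [CovariantDerivative.torsion_apply_eq_extend, conformalConnection_apply,
    extend_apply_self]
  abel

/-- With P = du∘φ² - dv∘φ and Q = du∘φ + dv∘φ², replacing y by φy turns (P, Q) into (-Q, P), which
matches the action of φ on φ²x and φx; the metric terms behave likewise. -/
lemma conformalFun_phi (u v w : M → ℝ) (a : M) (x y : TangentSpace I a) :
    S.conformalFun u v w a x (S.phi a y) = S.phi a (S.conformalFun u v w a x y) := by
  have h1 : S.g a (S.phi a x) (S.phi a (S.phi a y)) = -S.g a x (S.phi a y) := by
    rw [S.g_phi_left, S.phi_phi, S.eta_phi]; simp [g]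
  have h2 : S.g a x (S.phi a (S.phi a y)) = S.g a (S.phi a x) (S.phi a y) :=
    (S.g_phi_left a _ _).symm
  have h3 : ∀ z, S.phi a (S.phi a (S.phi a z)) = -S.phi a z := fun z ↦ by
    rw [S.phi_phi, S.eta_phi]; simp
  simp only [conformalFun, h1, h2, h3, map_add, map_sub, map_neg, map_smul, S.phi_xi, S.eta_phi]
  module

lemma conformalFun_xi (u v w : M → ℝ) (a : M) (x : TangentSpace I a) :
    S.conformalFun u v w a x (S.xi a) = mvfderiv I w a x • S.xi a := by
  simp [conformalFun, S.phi_xi, S.eta_xi]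

lemma eta_conformalFun (u v w : M → ℝ) (a : M) (x y : TangentSpace I a) :
    S.eta a (S.conformalFun u v w a x y) = mvfderiv I w a x * S.eta a y := by
  simp [conformalFun, S.eta_phi, S.eta_xi]

lemma g_grad_left (f : M → ℝ) (a : M) (z : TangentSpace I a) :
    S.g a (S.metric.grad f a) z = mvfderiv I f a z := by
  simp [g, PseudoMetric.grad]

lemma g_conformalFun (u v w : M → ℝ) (a : M) (x y z : TangentSpace I a) :
    S.g a (S.conformalFun u v w a x y) z
      = mvfderiv I u a x * S.g a y z + mvfderiv I v a x * S.g a y (S.phi a z)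
        + (mvfderiv I w a x - mvfderiv I u a x) * (S.eta a y * S.eta a z)
        + (1 / 2) *
          ((mvfderiv I u a (S.phi a (S.phi a y)) - mvfderiv I v a (S.phi a y))
              * (-S.g a x z + S.eta a x * S.eta a z)
            - (mvfderiv I u a (S.phi a y) + mvfderiv I v a (S.phi a (S.phi a y)))
              * S.g a x (S.phi a z)
            - (-S.g a x y + S.eta a x * S.eta a y)
              * (mvfderiv I u a (S.phi a (S.phi a z)) - mvfderiv I v a (S.phi a z))
            + S.g a x (S.phi a y)
              * (mvfderiv I u a (S.phi a z) + mvfderiv I v a (S.phi a (S.phi a z)))) := by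
  have h1 : ∀ b c, S.g a (S.phi a (S.phi a b)) c = -S.g a b c + S.eta a b * S.eta a c := by
    intro b c
    have := S.xi_g a c
    rw [S.phi_phi]
    simp only [g, map_add, map_neg, map_smul, add_apply, neg_apply, smul_apply, smul_eq_mul] at *
    rw [this]
  have h2 : ∀ b c, S.g a (S.phi a (S.phi a b)) c = S.g a b (S.phi a (S.phi a c)) := by
    intro b c
    rw [S.g_phi_left, S.g_phi_left]
  have e1 := h1 y z
  have e2 := h1 x z
  have e3 := S.g_phi_left a y z
  have e4 := S.g_phi_left a x z
  have e5 := S.metric_phi a x y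
  have e6 := (S.g_phi_left a _ _).trans (S.g_grad_left u a (S.phi a z))
  have e7 := (S.g_phi_left a _ _).trans (S.g_grad_left v a (S.phi a z))
  have e8 := (h2 _ _).trans (S.g_grad_left u a (S.phi a (S.phi a z)))
  have e9 := (h2 _ _).trans (S.g_grad_left v a (S.phi a (S.phi a z)))
  have e10 := S.xi_g a z
  rw [conformalFun]
  simp only [g, map_add, map_sub, map_neg, map_smul, add_apply, sub_apply, neg_apply, smul_apply,
    smul_eq_mul] at *
  rw [e1, e2, e3, e4, e5, e6, e7, e8, e9, e10]
  ring

/-- The bracketed half of the tensor is skew in y, z and drops out; what remains matches the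
derivative of the conformal factors. -/
lemma g_conformalFun_add (u v w : M → ℝ) (a : M) (x y z : TangentSpace I a) :
    S.g a (S.conformalFun u v w a x y) z + S.g a y (S.conformalFun u v w a x z)
      = 2 * (mvfderiv I u a x * S.g a y z + mvfderiv I v a x * S.g a y (S.phi a z)
        + (mvfderiv I w a x - mvfderiv I u a x) * (S.eta a y * S.eta a z)) := by
  rw [S.g_symm a y (S.conformalFun u v w a x z), g_conformalFun, g_conformalFun]
  rw [S.g_symm a z y, S.g_symm a z (S.phi a y), S.g_phi_left]
  ring

/-- With P, Q as in `conformalFun_phi`, the terms outside the bracket contribute P(y)g(x,z) +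
Q(y)g(x,φz) antisymmetrized in y, z. The bracket, with its factor 1/2, contributes the opposite. -/
lemma horizontalTorsion_conformalFun (u v w : M → ℝ) (a : M) :
    S.HorizontalTorsion a
      (fun x y ↦ S.conformalFun u v w a x y - S.conformalFun u v w a y x) := by
  intro x y z hy hz
  have h1 := S.g_symm a y x
  have h2 := S.g_symm a z x
  have h3 := S.g_symm a z y
  have h4 : ∀ b, S.eta a b = 0 → S.g a b (S.xi a) = 0 := fun b hb ↦ (S.g_xi a b).trans hb
  have h9 := h4 y hy
  have h10 := h4 z hz
  have h5 : ∀ b c, S.g a (S.phi a b) c = S.g a b (S.phi a c) := S.g_phi_left a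
  have h6 := (S.g_phi_left a y x).symm.trans (S.g_symm a (S.phi a y) x)
  have h7 := (S.g_phi_left a z x).symm.trans (S.g_symm a (S.phi a z) x)
  have h8 := (S.g_phi_left a z y).symm.trans (S.g_symm a (S.phi a z) y)
  simp only [g, map_sub, sub_apply]
  simp only [g] at h5
  have h := fun x y z ↦ S.g_conformalFun u v w a x y z
  simp only [g] at h h1 h2 h3 h6 h7 h8 h9 h10
  simp only [h, h5, S.phi_phi_of_eta_eq_zero hy, S.phi_phi_of_eta_eq_zero hz, S.eta_phi, hy, hz,
    map_neg, S.phi_phi a x, map_add, map_smul, smul_eq_mul, h1, h2, h3, h6, h7, h8, h9, h10]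
  ring

lemma mvfderiv_comp_hasDerivAt {f : M → ℝ} {a : M} {k : ℝ → ℝ} {k' : ℝ} (hf : MDiffAt f a)
    (hk : HasDerivAt k k' (f a)) (x : TangentSpace I a) :
    mvfderiv I (fun b ↦ k (f b)) a x = k' * mvfderiv I f a x := by
  have h := mvfderiv_comp_apply a hk.differentiableAt.mdifferentiableAt hf x
  have h' : mvfderiv I (fun b ↦ k (f b)) a x = fderiv ℝ k (f a) (mvfderiv I f a x) := by
    rw [← mfderiv_eq_fderiv]
    exact h
  rw [h', hk.hasFDerivAt.fderiv]
  simp [mul_comm]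

lemma mdiffAt_comp_hasDerivAt {f : M → ℝ} {a : M} {k : ℝ → ℝ} {k' : ℝ} (hf : MDiffAt f a)
    (hk : HasDerivAt k k' (f a)) : MDiffAt (fun b ↦ k (f b)) a :=
  hk.differentiableAt.mdifferentiableAt.comp a hf

/-! ### The transformed connection for the transformed structure -/

namespace IsContactlyConformal

variable {S} {S' : AlmostContactBMetric I M} {u v w : M → ℝ}

/-- Both structures have the same φ and ker η. On ker η the new metric combines g(·, z) and g(·,
φz), so the new condition is the same combination of the old one at (y, z) and at (y, φz). -/
lemma horizontalTorsion (h : S.IsContactlyConformal S' u v w) {p : M}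
    {T : TangentSpace I p → TangentSpace I p → TangentSpace I p} (hneg : ∀ x y, T x (-y) = -T x y)
    (hT : S.HorizontalTorsion p T) : S'.HorizontalTorsion p T := by
  intro x y z hy hz
  have hη : ∀ b, S'.eta p b = 0 → S.eta p b = 0 := by
    intro b hb
    rw [h.eta_eq] at hb
    simpa using hb
  replace hy := hη y hy
  replace hz := hη z hz
  have h1 := hT x y z hy hz
  have h2 := hT x y (S.phi p z) hy (S.eta_phi p z)
  simp only [h.phi_eq, h.metric_eq, S.eta_phi, hy, hz]
  simp only [S.phi_phi_of_eta_eq_zero hy, S.phi_phi_of_eta_eq_zero hz, hneg, g, map_neg, neg_apply]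
    at h1 h2 ⊢
  linear_combination (Real.exp (2 * u p) * Real.cos (2 * v p)) * h1
    + (Real.exp (2 * u p) * Real.sin (2 * v p)) * h2

lemma metric_parallel (h : S.IsContactlyConformal S' u v w) {p : M} (hu : MDiffAt u p)
    (hv : MDiffAt v p) (hw : MDiffAt w p) {Y Z : Π p : M, TangentSpace I p}
    (hY : MDiffAt (T% Y) p) (hZ : MDiffAt (T% Z) p) (x : TangentSpace I p) :
    mvfderiv I (fun q ↦ S'.g q (Y q) (Z q)) p x
      = S'.g p (S.conformalConnection u v w Y p x) (Z p)
        + S'.g p (Y p) (S.conformalConnection u v w Z p x) := by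
  set α : M → ℝ := fun q ↦ Real.exp (2 * u q) with hα
  set β : M → ℝ := fun q ↦ Real.cos (2 * v q) with hβ
  set γ : M → ℝ := fun q ↦ Real.sin (2 * v q) with hγ
  set δ : M → ℝ := fun q ↦ Real.exp (2 * w q) with hδ
  have hD := S.isNatural_phiCanonical
  have key : (fun q ↦ S'.g q (Y q) (Z q))
      = α * β * (fun q ↦ S.g q (Y q) (Z q)) + α * γ * (fun q ↦ S.g q (Y q) (S.phiField Z q))
        + (δ - α * β) * (S.etaField Y * S.etaField Z) := by
    funext q
    simp [h.metric_eq, α, β, γ, δ, phiField, etaField]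
  have he : ∀ t : ℝ, HasDerivAt (fun s ↦ Real.exp (2 * s)) (Real.exp (2 * t) * 2) t := fun t ↦ by
    simpa using ((hasDerivAt_id t).const_mul 2).exp
  have hc : ∀ t : ℝ, HasDerivAt (fun s ↦ Real.cos (2 * s)) (-Real.sin (2 * t) * 2) t := fun t ↦ by
    simpa using ((hasDerivAt_id t).const_mul 2).cos
  have hs : ∀ t : ℝ, HasDerivAt (fun s ↦ Real.sin (2 * s)) (Real.cos (2 * t) * 2) t := fun t ↦ by
    simpa using ((hasDerivAt_id t).const_mul 2).sin
  have mα : MDiffAt α p := mdiffAt_comp_hasDerivAt (k := fun s ↦ Real.exp (2 * s)) hu (he _)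
  have mβ : MDiffAt β p := mdiffAt_comp_hasDerivAt (k := fun s ↦ Real.cos (2 * s)) hv (hc _)
  have mγ : MDiffAt γ p := mdiffAt_comp_hasDerivAt (k := fun s ↦ Real.sin (2 * s)) hv (hs _)
  have mδ : MDiffAt δ p := mdiffAt_comp_hasDerivAt (k := fun s ↦ Real.exp (2 * s)) hw (he _)
  have dα : mvfderiv I α p x = α p * 2 * mvfderiv I u p x :=
    mvfderiv_comp_hasDerivAt (k := fun s ↦ Real.exp (2 * s)) hu (he _) x
  have dβ : mvfderiv I β p x = -γ p * 2 * mvfderiv I v p x :=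
    mvfderiv_comp_hasDerivAt (k := fun s ↦ Real.cos (2 * s)) hv (hc _) x
  have dγ : mvfderiv I γ p x = β p * 2 * mvfderiv I v p x :=
    mvfderiv_comp_hasDerivAt (k := fun s ↦ Real.sin (2 * s)) hv (hs _) x
  have dδ : mvfderiv I δ p x = δ p * 2 * mvfderiv I w p x :=
    mvfderiv_comp_hasDerivAt (k := fun s ↦ Real.exp (2 * s)) hw (he _) x
  have hφZ := S.mdiffAt_phiField hZ
  have mYZ : MDiffAt (fun q ↦ S.g q (Y q) (Z q)) p := S.metric.mdiffAt_form hY hZ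
  have mYφZ : MDiffAt (fun q ↦ S.g q (Y q) (S.phiField Z q)) p := S.metric.mdiffAt_form hY hφZ
  have mηY := S.mdiffAt_etaField hY
  have mηZ := S.mdiffAt_etaField hZ
  have d1 := hD.metric_parallel p Y Z x hY hZ
  have d2 := hD.metric_parallel p Y (S.phiField Z) x hY hφZ
  have d3 := S.nablaEta_apply S.phiCanonical hY x
  have d4 := S.nablaEta_apply S.phiCanonical hZ x
  have d5 := S.nablaPhi_apply S.phiCanonical hZ x
  rw [hD.eta_parallel] at d3 d4
  rw [hD.phi_parallel] at d5
  replace d3 := sub_eq_zero.mp d3.symm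
  replace d4 := sub_eq_zero.mp d4.symm
  rw [sub_eq_zero.mp d5.symm] at d2
  have c1 := S.g_conformalFun_add u v w p x (Y p) (Z p)
  -- The sin 2v part of the new metric pairs Y with φZ, so the relation is needed there too. The
  -- dv-terms of `c1` and `c2` match the derivatives of cos 2v and sin 2v.
  have c2 := S.g_conformalFun_add u v w p x (Y p) (S.phi p (Z p))
  rw [conformalFun_phi] at c2
  rw [key, mvfderiv_add (((mα.mul mβ).mul mYZ).add ((mα.mul mγ).mul mYφZ))
      ((mδ.sub (mα.mul mβ)).mul (mηY.mul mηZ)),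
    mvfderiv_add ((mα.mul mβ).mul mYZ) ((mα.mul mγ).mul mYφZ), mvfderiv_mul (mα.mul mβ) mYZ,
    mvfderiv_mul (mα.mul mγ) mYφZ, mvfderiv_mul (mδ.sub (mα.mul mβ)) (mηY.mul mηZ),
    mvfderiv_sub mδ (mα.mul mβ), mvfderiv_mul mα mβ, mvfderiv_mul mα mγ, mvfderiv_mul mηY mηZ]
  simp only [h.metric_eq, conformalConnection_apply, map_add, S.eta_conformalFun]
  simp only [add_apply, sub_apply, smul_apply, smul_eq_mul, Pi.mul_apply, Pi.sub_apply]
  rw [d1, d2, d3, d4, dα, dβ, dγ, dδ]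
  simp only [g, etaField, phiField, map_add, add_apply, smul_eq_mul, S.eta_phi,
    S.phi_phi (v := Z p), map_neg, map_smul] at c1 c2 ⊢
  have e1 : S.metric.form p (Y p) (S.xi p) = S.eta p (Y p) := S.g_xi p _
  rw [e1] at c2
  rw [hα, hβ, hγ, hδ]
  linear_combination (-(Real.exp (2 * u p) * Real.cos (2 * v p))) * c1
    - (Real.exp (2 * u p) * Real.sin (2 * v p)) * c2

lemma isNatural (h : S.IsContactlyConformal S' u v w) (hu : MDiff u) (hv : MDiff v)
    (hw : MDiff w) : S'.IsNatural (S.conformalConnection u v w) where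
  phi_parallel p x y := by
    have hD := S.isNatural_phiCanonical
    have hy := mdifferentiableAt_extend I E y
    have h1 := S'.nablaPhi_apply (S.conformalConnection u v w) hy x
    have h2 := S.nablaPhi_apply S.phiCanonical hy x
    have h3 : S'.phiField (extend E y) = S.phiField (extend E y) := by
      funext q
      rw [phiField, h.phi_eq, phiField]
    rw [hD.phi_parallel] at h2
    rw [extend_apply_self, h3, h.phi_eq, conformalConnection_apply, conformalConnection_apply,
      map_add, sub_eq_zero.mp h2.symm, phiField, conformalFun_phi] at h1
    rw [h1, sub_self]
  xi_parallel p x := by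
    have hD := S.isNatural_phiCanonical
    have he : ∀ t : ℝ, HasDerivAt (fun s ↦ Real.exp (-s)) (Real.exp (-t) * -1) t := fun t ↦ by
      simpa using (hasDerivAt_id t).neg.exp
    have h1 : S'.xi = (fun q ↦ Real.exp (-w q)) • S.xi := funext fun q ↦ h.xi_eq q
    rw [h1, (S.conformalConnection u v w).isCovariantDerivativeOn.leibniz (S.mdiffAt_xi p)
      (mdiffAt_comp_hasDerivAt (k := fun s ↦ Real.exp (-s)) (hw p) (he _))]
    simp only [add_apply, smul_apply, ContinuousLinearMap.smulRight_apply,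
      mvfderiv_comp_hasDerivAt (k := fun s ↦ Real.exp (-s)) (hw p) (he _) x,
      conformalConnection_apply, hD.xi_parallel, conformalFun_xi]
    module
  eta_parallel p x y := by
    have hD := S.isNatural_phiCanonical
    have hy := mdifferentiableAt_extend I E y
    have h1 := S'.nablaEta_apply (S.conformalConnection u v w) hy x
    have h2 := S.nablaEta_apply S.phiCanonical hy x
    have he : ∀ t : ℝ, HasDerivAt Real.exp (Real.exp t) t := Real.hasDerivAt_exp
    have h3 : S'.etaField (extend E y) = (fun q ↦ Real.exp (w q)) * S.etaField (extend E y) := by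
      funext q
      simp [etaField, h.eta_eq]
    rw [hD.eta_parallel] at h2
    rw [extend_apply_self, h3, mvfderiv_mul (mdiffAt_comp_hasDerivAt (k := Real.exp) (hw p) (he _))
      (S.mdiffAt_etaField hy), h.eta_eq, conformalConnection_apply] at h1
    rw [h1]
    simp only [add_apply, smul_apply, smul_eq_mul,
      mvfderiv_comp_hasDerivAt (k := Real.exp) (hw p) (he _) x,
      sub_eq_zero.mp h2.symm, map_add, eta_conformalFun, etaField]
    ring
  metric_parallel p _ _ x hY hZ := h.metric_parallel (hu p) (hv p) (hw p) hY hZ x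

lemma phiCanonical_eq (h : S.IsContactlyConformal S' u v w) (hu : MDiff u) (hv : MDiff v)
    (hw : MDiff w) {Y : Π p : M, TangentSpace I p} {p : M} (hY : MDiffAt (T% Y) p)
    (x : TangentSpace I p) :
    S'.phiCanonical Y p x = S.phiCanonical Y p x + S.conformalFun u v w p x (Y p) := by
  refine (IsNatural.eq_of_horizontalTorsion S' S'.isNatural_phiCanonical (h.isNatural hu hv hw)
    (S'.horizontalTorsion_phiCanonical p) ?_ hY x).trans (conformalConnection_apply ..)
  refine h.horizontalTorsion (fun x y ↦ map_neg _ _) fun x y z hy hz ↦ ?_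
  have h1 := S.horizontalTorsion_phiCanonical p x y z hy hz
  have h2 := S.horizontalTorsion_conformalFun u v w p x y z hy hz
  simp only [conformalConnection_torsion, g, map_add, add_apply] at h1 h2 ⊢
  linear_combination h1 + h2

lemma torsion_eq (h : S.IsContactlyConformal S' u v w) (hu : MDiff u) (hv : MDiff v)
    (hw : MDiff w) (p : M) (x y : TangentSpace I p) :
    S'.phiCanonical.torsion p x y = S.phiCanonical.torsion p x y
      + (S.conformalFun u v w p x y - S.conformalFun u v w p y x) := by
  simp only [CovariantDerivative.torsion_apply_eq_extend,
    h.phiCanonical_eq hu hv hw (mdifferentiableAt_extend I E x),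
    h.phiCanonical_eq hu hv hw (mdifferentiableAt_extend I E y), extend_apply_self]
  abel

end IsContactlyConformal

end AlmostContactBMetric

end BMetric

end

/-! ### The transformation formulas -/

theorem mainTheorem6 (n : ℕ) {M : Type*} [TopologicalSpace M]
    [ChartedSpace (EuclideanSpace ℝ (Fin (2 * n + 1))) M] [IsManifold (𝓡 (2 * n + 1)) ∞ M]
    (S S' : BMetric.AlmostContactBMetric (𝓡 (2 * n + 1)) M) (u v w : M → ℝ)
    (hu : ContMDiff (𝓡 (2 * n + 1)) 𝓘(ℝ, ℝ) ∞ u)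
    (hv : ContMDiff (𝓡 (2 * n + 1)) 𝓘(ℝ, ℝ) ∞ v)
    (hw : ContMDiff (𝓡 (2 * n + 1)) 𝓘(ℝ, ℝ) ∞ w)
    (hG : S.IsContactlyConformal S' u v w) :
    S.IsPhiCanonical S.phiCanonical ∧ S'.IsPhiCanonical S'.phiCanonical ∧
    (∀ (a : M) (x : TangentSpace (𝓡 (2 * n + 1)) a)
        (Y : Π b : M, TangentSpace (𝓡 (2 * n + 1)) b),
      MDifferentiableAt (𝓡 (2 * n + 1))
        ((𝓡 (2 * n + 1)).prod 𝓘(ℝ, EuclideanSpace ℝ (Fin (2 * n + 1))))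
        (fun b ↦ TotalSpace.mk' (EuclideanSpace ℝ (Fin (2 * n + 1))) b (Y b)) a →
      let φ := S.phi a
      let du := mvfderiv (𝓡 (2 * n + 1)) u a
      let dv := mvfderiv (𝓡 (2 * n + 1)) v a
      let dw := mvfderiv (𝓡 (2 * n + 1)) w a
      let p := S.metric.grad u a
      let q := S.metric.grad v a
      let y := Y a
      S'.phiCanonical Y a x
        = S.phiCanonical Y a x
          - du x • φ (φ y) + dv x • φ y + (dw x * S.eta a y) • S.xi a
          + (1 / 2 : ℝ) •
            ((du (φ (φ y)) - dv (φ y)) • φ (φ x)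
              - (du (φ y) + dv (φ (φ y))) • φ x
              - S.g a (φ x) (φ y) • (φ (φ p) - φ q)
              + S.g a x (φ y) • (φ p + φ (φ q)))) ∧
    (∀ (a : M) (x y : TangentSpace (𝓡 (2 * n + 1)) a),
      let φ := S.phi a
      let η := S.eta a
      let ξ := S.xi a
      let du := mvfderiv (𝓡 (2 * n + 1)) u a
      let dv := mvfderiv (𝓡 (2 * n + 1)) v a
      let dw := mvfderiv (𝓡 (2 * n + 1)) w a
      let A := fun x y : TangentSpace (𝓡 (2 * n + 1)) a ↦
        (2 * dw x * η y) • ξ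
        + (du (φ (φ x)) + dv (φ x) - 2 * du ξ * η x) • φ (φ y)
        + (du (φ x) - dv (φ (φ x)) + 2 * dv ξ * η x) • φ y
      S'.phiCanonical.torsion a x y
        = S.phiCanonical.torsion a x y + (1 / 2 : ℝ) • (A x y - A y x)) := by
  have mu := hu.mdifferentiable (by simp)
  have mv := hv.mdifferentiable (by simp)
  have mw := hw.mdifferentiable (by simp)
  refine ⟨S.isPhiCanonical_phiCanonical, S'.isPhiCanonical_phiCanonical, ?_, ?_⟩
  · intro a x Y hY φ du dv dw p q y
    rw [hG.phiCanonical_eq mu mv mw hY, BMetric.AlmostContactBMetric.conformalFun]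
    module
  · intro a x y φ η ξ du dv dw A
    rw [hG.torsion_eq mu mv mw]
    -- g(φx, φy) and g(x, φy) are symmetric in x, y, so the gradient terms cancel in the torsion.
    have h1 := S.g_symm a (S.phi a x) (S.phi a y)
    have h2 := (S.g_phi_left a y x).symm.trans (S.g_symm a (S.phi a y) x)
    -- Splitting du(x) and dv(x) along ker η ⊕ ℝξ is what produces the terms du(ξ)η(x) and
    -- dv(ξ)η(x).
    have hd : ∀ (d : TangentSpace (𝓡 (2 * n + 1)) a →L[ℝ] ℝ) (z : TangentSpace (𝓡 (2 * n + 1)) a),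
        d z = -d (φ (φ z)) + η z * d ξ := by
      intro d z
      conv_lhs => rw [S.eq_phi_phi a z]
      simp [φ, η, ξ]
    have hux := hd du x
    have huy := hd du y
    have hvx := hd dv x
    have hvy := hd dv y
    simp only [BMetric.AlmostContactBMetric.conformalFun, A]
    rw [h1, h2]
    simp only [φ, η, ξ, du, dv, dw] at hux huy hvx hvy ⊢
    rw [hux, huy, hvx, hvy]
    module
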